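/- Let $H_4(x)=-x\log_4\frac{x}{3}-(1-x)\log_4(1-x)$ and let $H_4^{-1}:[0,1]\to[0,\tfrac34]$ be the inverse of the increasing bijection $H_4:[0,\tfrac34]\to[0,1]$. **Codes.** Write $\mathbb F_4=\{0,1,\omega,\omega^2\}$ with $\omega^2=\omega+1$ and $\bar x=x^2$, and put $\langle u,v\rangle=\sum_i(u_i\bar v_i+\bar u_iv_i)$ on $\mathbb F_4^n$. For an additive subgroup $C\subseteq\mathbb F_4^n$, $C^\perp$ denotes its dual with respect to $\langle\cdot,\cdot\rangle$. A quantum code of length $n$ is an additive $C\subseteq\mathbb F_4^n$ with $C\subseteq C^\perp$; it encodes $k$ qubits if $|C|=2^{n-k}$, its rate is $k/n$, its minimum distance $d$ is the least weight of a vector of $C^\perp\setminus C$, and its relative distance is $d/n$. **Quantum Reed–Solomon codes.** Let $n_1=2^m-1$ and $1\le k\le 2^{m-1}-1$. Let $C_{\rm RS}\subseteq\mathbb F_{2^m}^{n_1}$ be the cyclic code with generator polynomial $\prod_{i=0}^{n_1-k-1}(x-\alpha^i)$, $\alpha$ a primitive element of $\mathbb F_{2^m}$, and let $\mathcal B$ be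 a self-dual basis of $\mathbb F_{2^m}$ over $\mathbb F_2$ (for the trace form). The quantum RS code with parameters $(m,k)$ is given by the additive code $\omega\mathcal B(C_{\rm RS})+\bar\omega\mathcal B(C_{\rm RS})\subseteq\mathbb F_4^{mn_1}$, where $\mathcal B(C_{\rm RS})$ is the binary expansion of $C_{\rm RS}$ in the basis $\mathcal B$. **Generalized concatenated quantum codes of order $s\ge2$.** Take quantum RS codes $B_1,\dots,B_s$ with parameters $(m,k_1),\dots,(m,k_s)$, and quantum codes $C_s\subseteq C_{s-1}\subseteq\cdots\subseteq C_1$ of a common length $n_2$, with $C_j$ encoding $jm$ qubits. Choose vectors $g_{j,a},h_{j,a}\in C_j^\perp$ ($1\le j\le s$, $1\le a\le m$) with $\langle g_{i,a},h_{j,b}\rangle=1$ if $(i,a)=(j,b)$ and $0$ otherwise, and $\langle g_{i,a},g_{j,b}\rangle=\langle h_{i,a},h_{j,b}\rangle=0$. Let $\rho:\mathbb F_4^{sm}\to C_s^\perp/C_s$ be the additive (inner-product-preserving) map that sends $\omega$ (respectively $\bar\omega$) in coordinate $(j,a)$ to the class of $g_{j,a}$ (respectively $h_{j,a}$). The generalized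 concatenated quantum code is the quantum code of length $N=n_1n_2$ given by the additive code of all $(c_1,\dots,c_{n_1})\in(\mathbb F_4^{n_2})^{n_1}$ for which there are $b_i\in B_i$ ($1\le i\le s$), regarded as the rows of an $s\times n_1$ matrix over $\mathbb F_4^m$, such that $c_l\in\rho(l\text{-th column})$ for every $l$. **Statement.** Let $0<\delta<H_4^{-1}(1/2)$ and put $$R(\delta)=1-2H_4(\delta)-\delta\int_0^{1-2H_4(\delta)}\frac{dx}{H_4^{-1}\left(\frac{1-x}{2}\right)}.$$ For every $\varepsilon>0$ there is an $s_0$ such that for every $s\ge s_0$ there is an $m_0$ such that for every $m\ge m_0$ there is a generalized concatenated quantum code of order $s$ with outer quantum RS codes over $\mathbb F_{2^m}$ (in particular, for each such $s$, there are such codes of unbounded length) that has relative distance at least $\delta/2$ and rate $R$ with $|R-R(\delta)|<\varepsilon$. -/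

import Mathlib

namespace QBZ

/-! ### Entropy -/

/-- The quaternary entropy function `H₄(x) = -x log₄ (x/3) - (1-x) log₄ (1-x)`. -/
noncomputable def H4 (x : ℝ) : ℝ := Real.qaryEntropy 4 x / Real.log 4

/-- The inverse of `H₄` on its increasing branch, the bijection `[0, 3/4] → [0, 1]`. -/
noncomputable def H4inv : ℝ → ℝ := Function.invFunOn H4 (Set.Icc 0 (3 / 4))

/-- The right-hand side of the quantum Blokh–Zyablov bound. -/
noncomputable def bzRate (δ : ℝ) : ℝ :=
  1 - 2 * H4 δ - δ * ∫ x in (0 : ℝ)..(1 - 2 * H4 δ), 1 / H4inv ((1 - x) / 2)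

/-! ### The field with four elements and additive codes over it -/

/-- The field with four elements. -/
abbrev F4 : Type := GaloisField 2 2

theorem exists_omega : ∃ w : F4, w ^ 2 = w + 1 := by
  classical
  let _ : Fintype F4 := Fintype.ofFinite F4
  have hcard : Fintype.card F4 = 4 := by
    have h := GaloisField.card 2 2 (by norm_num)
    rw [Nat.card_eq_fintype_card] at h
    simpa using h
  obtain ⟨x, hx⟩ : ∃ x : F4, x ∉ ({0, 1} : Finset F4) := by
    by_contra hcon
    push Not at hcon
    have h1 : (Finset.univ : Finset F4) ⊆ {0, 1} := fun x _ => hcon x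
    have h2 := Finset.card_le_card h1
    have h3 : ({0, 1} : Finset F4).card ≤ 2 := Finset.card_le_two
    rw [Finset.card_univ, hcard] at h2
    omega
  simp only [Finset.mem_insert, Finset.mem_singleton, not_or] at hx
  have h4 : x ^ 4 = x := by
    have h := FiniteField.pow_card x
    rwa [hcard] at h
  have h2 : (2 : F4) = 0 := by
    have h := CharP.cast_eq_zero F4 2
    exact_mod_cast h
  have hne : x - 1 ≠ 0 := sub_ne_zero.mpr hx.2
  have hprod : x * ((x - 1) * (x ^ 2 + x + 1)) = 0 := by linear_combination h4
  rcases mul_eq_zero.mp hprod with h | h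
  · exact absurd h hx.1
  rcases mul_eq_zero.mp h with h | h
  · exact absurd h hne
  exact ⟨x, by linear_combination h - (x + 1) * h2⟩

/-- A primitive element of `𝔽₄`, with `ω² = ω + 1`; its conjugate is `ω²`. -/
noncomputable def omega : F4 := Classical.choose exists_omega

theorem add_sq (a b : F4) : (a + b) ^ 2 = a ^ 2 + b ^ 2 := add_pow_char a b 2

theorem neg_sq_self (a : F4) : (-a) ^ 2 = -(a ^ 2) := by
  rw [CharTwo.neg_eq, CharTwo.neg_eq]

/-- The trace form `u v̄ + ū v` on `𝔽₄`, where `x̄ = x²`. Its values lie in `𝔽₂ = {0, 1}`. -/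
noncomputable def traceForm (x y : F4) : F4 := x * y ^ 2 + x ^ 2 * y

/-- The trace inner product on `𝔽₄ⁿ`, with coordinates indexed by a finite type. -/
noncomputable def traceInner {ι : Type*} [Fintype ι] (u v : ι → F4) : F4 :=
  ∑ i, traceForm (u i) (v i)

theorem traceForm_add_left (x x' y : F4) :
    traceForm (x + x') y = traceForm x y + traceForm x' y := by
  simp only [traceForm, add_sq]; ring

theorem traceForm_zero_left (y : F4) : traceForm 0 y = 0 := by simp [traceForm]

theorem traceForm_neg_left (x y : F4) : traceForm (-x) y = -traceForm x y := by
  simp only [traceForm, neg_sq_self]; ring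

/-- The trace-dual of an additive code over `𝔽₄`. -/
noncomputable def traceDual {ι : Type*} [Fintype ι] (C : AddSubgroup (ι → F4)) :
    AddSubgroup (ι → F4) where
  carrier := {u | ∀ v ∈ C, traceInner u v = 0}
  zero_mem' := fun v _ => by simp [traceInner, traceForm_zero_left]
  add_mem' := fun {a b} ha hb v hv => by
    have h1 := ha v hv
    have h2 := hb v hv
    simp only [traceInner] at h1 h2 ⊢
    simp only [Pi.add_apply, traceForm_add_left, Finset.sum_add_distrib, h1, h2, add_zero]
  neg_mem' := fun {a} ha v hv => by
    have h1 := ha v hv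
    simp only [traceInner] at h1 ⊢
    simp only [Pi.neg_apply, traceForm_neg_left, Finset.sum_neg_distrib, h1, neg_zero]

/-- A stabilizer quantum code on qubits indexed by `ι`: a self-orthogonal additive code `C`
over `𝔽₄`, with `C ⊆ C^⊥`. -/
structure QuantumCode (ι : Type*) [Fintype ι] where
  stab : AddSubgroup (ι → F4)
  selfOrthogonal : stab ≤ traceDual stab

/-- The code encodes `k` qubits in `n` qubits: `|C| = 2^(n-k)`. -/
def QuantumCode.Encodes {ι : Type*} [Fintype ι] (Q : QuantumCode ι) (k : ℕ) : Prop :=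
  Nat.card Q.stab * 2 ^ k = 2 ^ Fintype.card ι

open Classical in
/-- The minimum distance of the code is `d`: the smallest weight of a vector in `C^⊥ ∖ C`. -/
def QuantumCode.HasMinDist {ι : Type*} [Fintype ι] (Q : QuantumCode ι) (d : ℕ) : Prop :=
  IsLeast {w : ℕ | ∃ u ∈ traceDual Q.stab, u ∉ Q.stab ∧ hammingNorm u = w} d

/-! ### Quantum Reed–Solomon codes -/

/-- The cyclic code of length `n` over `F` with generator polynomial
`g(x) = ∏_{i=0}^{d-2} (x - αⁱ)`; a word `c` is identified with `∑ᵢ cᵢ xⁱ`. -/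
noncomputable def reedSolomon {F : Type*} [Field F] (α : F) (n d : ℕ) :
    Submodule F (Fin n → F) where
  carrier := {c | (∏ i ∈ Finset.range (d - 1), (Polynomial.X - Polynomial.C (α ^ i))) ∣
    ∑ i : Fin n, Polynomial.C (c i) * Polynomial.X ^ (i : ℕ)}
  zero_mem' := by simp
  add_mem' := fun {a b} ha hb => by
    have h := dvd_add ha hb
    simpa only [Set.mem_ofPred_eq, Pi.add_apply, map_add, add_mul, Finset.sum_add_distrib] using h
  smul_mem' := fun r {a} ha => by
    have h := Dvd.dvd.mul_left ha (Polynomial.C r)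
    simpa only [Set.mem_ofPred_eq, Pi.smul_apply, smul_eq_mul, map_mul, Finset.mul_sum,
      mul_assoc] using h

/-- The binary expansion of a linear code over an extension `F` of `𝔽₂` with respect to a basis. -/
def binaryExpansion {F : Type*} [Field F] [Algebra (ZMod 2) F] {n m : ℕ}
    (b : Module.Basis (Fin m) (ZMod 2) F) (C : Submodule F (Fin n → F)) :
    AddSubgroup (Fin n × Fin m → ZMod 2) where
  carrier := {c | (fun i => ∑ j, c (i, j) • b j) ∈ C}
  zero_mem' := by
    simp only [Set.mem_ofPred_eq, Pi.zero_apply, zero_smul, Finset.sum_const_zero]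
    exact C.zero_mem
  add_mem' := fun {x y} hx hy => by
    have h := C.add_mem hx hy
    simp only [Set.mem_ofPred_eq, Pi.add_apply, add_smul, Finset.sum_add_distrib]
    exact h
  neg_mem' := fun {x} hx => by
    have h := C.neg_mem hx
    simp only [Set.mem_ofPred_eq, Pi.neg_apply, neg_smul, Finset.sum_neg_distrib]
    exact h

/-- The additive code `ω D + ω̄ D` over `𝔽₄` attached to a binary linear code `D`. -/
noncomputable def quaternaryLift {ι : Type*} (D : AddSubgroup (ι → ZMod 2)) :
    AddSubgroup (ι → F4) where
  carrier := {u | ∃ x ∈ D, ∃ y ∈ D, u = fun i =>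
    omega * algebraMap (ZMod 2) F4 (x i) + omega ^ 2 * algebraMap (ZMod 2) F4 (y i)}
  zero_mem' := ⟨0, D.zero_mem, 0, D.zero_mem, by funext i; simp⟩
  add_mem' := by
    rintro _ _ ⟨x, hx, y, hy, rfl⟩ ⟨x', hx', y', hy', rfl⟩
    refine ⟨x + x', D.add_mem hx hx', y + y', D.add_mem hy hy', ?_⟩
    funext i
    simp only [Pi.add_apply, map_add]; ring
  neg_mem' := by
    rintro _ ⟨x, hx, y, hy, rfl⟩
    refine ⟨-x, D.neg_mem hx, -y, D.neg_mem hy, ?_⟩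
    funext i
    simp only [Pi.neg_apply, map_neg]; ring

/-- `B` is the stabilizer of a quantum Reed–Solomon code `[[mn, m(n-2k)]]`, `n = 2^m - 1`: it is
`ω 𝓑(C) + ω̄ 𝓑(C)` for a Reed–Solomon code `C` over `𝔽_{2^m}` of length `n`, dimension `k` (so
designed distance `d = n - k + 1`), `1 ≤ k ≤ 2^(m-1) - 1`, and a trace-self-dual basis `𝓑`. -/
def IsQuantumReedSolomon (m k : ℕ) (B : AddSubgroup (Fin (2 ^ m - 1) × Fin m → F4)) : Prop :=
  1 ≤ k ∧ k ≤ 2 ^ (m - 1) - 1 ∧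
  ∃ α : GaloisField 2 m, IsPrimitiveRoot α (2 ^ m - 1) ∧
  ∃ b : Module.Basis (Fin m) (ZMod 2) (GaloisField 2 m),
    (∀ i j, Algebra.trace (ZMod 2) (GaloisField 2 m) (b i * b j) = if i = j then 1 else 0) ∧
    B = quaternaryLift (binaryExpansion b (reedSolomon α (2 ^ m - 1) ((2 ^ m - 1) - k + 1)))

/-! ### Generalized concatenated quantum codes -/

/-- The ingredients of a generalized concatenated quantum code of order `s ≥ 2`, with outer
Reed–Solomon codes over `𝔽_{2^m}` and inner codes of length `n₂`. The index `j : Fin s` stands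
for `j + 1 ∈ {1, …, s}`. -/
structure GCData (s m n₂ : ℕ) where
  two_le : 2 ≤ s
  /-- The dimensions of the Reed–Solomon codes. -/
  k : Fin s → ℕ
  /-- The stabilizers `B₁, …, B_s` of the outer codes. -/
  outer : Fin s → AddSubgroup (Fin (2 ^ m - 1) × Fin m → F4)
  outer_isRS : ∀ i, IsQuantumReedSolomon m (k i) (outer i)
  /-- The inner codes, nested: `C_s ⊆ ⋯ ⊆ C₁`. -/
  inner : Fin s → QuantumCode (Fin n₂)
  inner_encodes : ∀ j, (inner j).Encodes (((j : ℕ) + 1) * m)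
  inner_nested : ∀ i j, i ≤ j → (inner j).stab ≤ (inner i).stab
  /-- The `j`-th set of `2m` vectors `g`, `h` lies in `C_j^⊥`, and all of them together satisfy
  the symplectic relations (hence give a symplectic basis of `C_s^⊥ / C_s`). -/
  g : Fin s → Fin m → (Fin n₂ → F4)
  h : Fin s → Fin m → (Fin n₂ → F4)
  g_mem : ∀ j a, g j a ∈ traceDual (inner j).stab
  h_mem : ∀ j a, h j a ∈ traceDual (inner j).stab
  inner_g_h : ∀ i a j b, traceInner (g i a) (h j b) = if i = j ∧ a = b then 1 else 0
  inner_g_g : ∀ i a j b, traceInner (g i a) (g j b) = 0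
  inner_h_h : ∀ i a j b, traceInner (h i a) (h j b) = 0

namespace GCData

variable {s m n₂ : ℕ}

/-- The smallest inner stabilizer `C_s`. -/
def lastStab (D : GCData s m n₂) : AddSubgroup (Fin n₂ → F4) :=
  (D.inner ⟨s - 1, Nat.sub_lt (lt_of_lt_of_le two_pos D.two_le) one_pos⟩).stab

/-- A representative of the inner-product-preserving map `𝔽₄^{sm} → C_s^⊥ / C_s`: it is additive,
takes `ω` in coordinate `(j, a)` to `g j a` and `ω̄` there to `h j a`. (Every `x ∈ 𝔽₄` equals
`⟨x, ω̄⟩ ω + ⟨x, ω⟩ ω̄`.) -/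
noncomputable def rho (D : GCData s m n₂) : (Fin s → Fin m → F4) →+ (Fin n₂ → F4) where
  toFun x := ∑ j, ∑ a, (traceForm (x j a) (omega ^ 2) • D.g j a +
    traceForm (x j a) omega • D.h j a)
  map_zero' := by simp [traceForm_zero_left]
  map_add' x y := by
    simp only [Pi.add_apply, traceForm_add_left, ← Finset.sum_add_distrib]
    refine Finset.sum_congr rfl fun j _ => Finset.sum_congr rfl fun a _ => ?_
    rw [add_smul, add_smul]; abel

/-- The `l`-th column, in `𝔽₄^{sm}`, of the `s × n₁` matrix over `𝔽₄^m` whose rows are the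
words `b i`. -/
def column {n₁ : ℕ} (b : Fin s → (Fin n₁ × Fin m → F4)) (l : Fin n₁) : Fin s → Fin m → F4 :=
  fun i a => b i (l, a)

/-- The stabilizer of the generalized concatenated code: all words whose `l`-th block lies in the
coset `ρ(l-th column of b) + C_s` for each `l`, for some `b ∈ B₁ ⊕ ⋯ ⊕ B_s`. -/
noncomputable def code (D : GCData s m n₂) : AddSubgroup (Fin (2 ^ m - 1) × Fin n₂ → F4) where
  carrier := {c | ∃ b : Fin s → (Fin (2 ^ m - 1) × Fin m → F4), (∀ i, b i ∈ D.outer i) ∧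
    ∀ l, (fun t => c (l, t)) - D.rho (column b l) ∈ D.lastStab}
  zero_mem' := ⟨0, fun i => (D.outer i).zero_mem, fun l => by
    have h1 : D.rho (column (0 : Fin s → (Fin (2 ^ m - 1) × Fin m → F4)) l) = 0 :=
      D.rho.map_zero
    rw [h1, sub_zero]
    exact D.lastStab.zero_mem⟩
  add_mem' := by
    rintro c c' ⟨b, hb, hc⟩ ⟨b', hb', hc'⟩
    refine ⟨b + b', fun i => (D.outer i).add_mem (hb i) (hb' i), fun l => ?_⟩
    have h1 : D.rho (column (b + b') l) = D.rho (column b l) + D.rho (column b' l) :=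
      D.rho.map_add _ _
    have h2 := D.lastStab.add_mem (hc l) (hc' l)
    rw [h1]
    rw [sub_add_sub_comm] at h2
    exact h2
  neg_mem' := by
    rintro c ⟨b, hb, hc⟩
    refine ⟨-b, fun i => (D.outer i).neg_mem (hb i), fun l => ?_⟩
    have h1 : D.rho (column (-b) l) = -D.rho (column b l) := D.rho.map_neg _
    have h2 := D.lastStab.neg_mem (hc l)
    rw [neg_sub'] at h2
    rw [h1]
    exact h2

end GCData

/-- `Q` is a generalized concatenated quantum code of order `s`, with outer quantum Reed–Solomon
codes over `𝔽_{2^m}` (of length `n₁ = 2^m - 1`) and inner quantum codes of length `n₂`. -/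
def IsGeneralizedConcatenated (s m n₂ : ℕ) (Q : QuantumCode (Fin (2 ^ m - 1) × Fin n₂)) : Prop :=
  ∃ D : GCData s m n₂, Q.stab = D.code

end QBZ

namespace QBZ

/-! ### The trace form as a symplectic form over `ZMod 2` -/

/-! Throughout, n₁ = 2^m - 1, n is the inner length and ρ = 1 - 2 H₄(δ).

Distance. The map `GCData.coords`, which pairs a word with all the vectors h and g, is adjoint to
`GCData.rho` and inverts it on the left (`symp_rho`, `coords_rho`). Hence a word of the dual of the
concatenated code has its blocks in C_s^⊥, and its coordinates form rows b_i in the duals of the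
outer codes. Outside the code some b_i is nonzero, by `mem_lastStab`; take the largest such i. More
than k_i columns of b_i are nonzero (`lt_card_blocks`), and each gives a block in C_i^⊥ outside C_i.
So the weight is at least (k_i + 1) w_i for some i, where w_i bounds the i-th inner distance from
below (`exists_le_hammingNorm`).

Inner codes. The isometries of the trace inner product act transitively on nonzero words, so a
random one sends a given nonzero word to another given one with probability 1/(4^n - 1)
(`exists_isometry_avoiding`). Moving a standard nested chain by a single isometry and taking a union
bound over all s codes puts them near the Gilbert–Varshamov bound simultaneously
(`exists_isometry_hammingNorm`). If sm/n is slightly below ρ, the j-th code can have relative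
distance τ_j = H₄⁻¹((1 - jρ/s)/2), by `sum_ballCard_lt`.

Parameters. An outer code loses 2k of its length in rate and gains dual distance k + 1, which is the
source of the factor 1/2 in δ/2. With k_j about δ n₁/(2 τ_j), every product (k_j + 1) w_j reaches δ
n₁ n/2, and the rate is about (ρ/s) ∑ (1 - δ/τ_j), a Riemann sum for R(δ)
(`abs_riemann_sub_bzRate_le`). -/

theorem omega_sq : omega ^ 2 = omega + 1 := Classical.choose_spec exists_omega

theorem two_eq_zero : (2 : F4) = 0 := by
  have h := CharP.cast_eq_zero F4 2
  exact_mod_cast h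

theorem natCard_F4 : Nat.card F4 = 4 := by
  rw [GaloisField.card 2 2 (by norm_num)]; norm_num

theorem F4_pow_four (x : F4) : x ^ 4 = x := by
  have := Fintype.ofFinite F4
  have h := FiniteField.pow_card x
  rwa [← Nat.card_eq_fintype_card, natCard_F4] at h

/-- The trace form with values in `ZMod 2`. -/
noncomputable def binTrace (x y : F4) : ZMod 2 := Algebra.trace (ZMod 2) F4 (x * y ^ 2)

/-- The conjugate of x y² is x² y⁴ = x² y, so the trace form is a field trace. This makes linear
algebra over 𝔽₂ available for additive codes. -/
theorem algebraMap_binTrace (x y : F4) :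
    algebraMap (ZMod 2) F4 (binTrace x y) = traceForm x y := by
  have hf : Module.finrank (ZMod 2) F4 = 2 := GaloisField.finrank 2 (by norm_num)
  rw [binTrace, FiniteField.algebraMap_trace_eq_sum_pow, hf, Nat.card_zmod]
  simp only [Finset.sum_range_succ, Finset.sum_range_zero, pow_zero, pow_one, zero_add, traceForm]
  linear_combination x ^ 2 * F4_pow_four y

theorem algebraMap_smul_eq {ι : Type*} (r : ZMod 2) (u : ι → F4) :
    algebraMap (ZMod 2) F4 r • u = r • u := algebraMap_smul F4 r u

variable {ι : Type*} [Fintype ι]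

/-- The trace inner product as a bilinear form over `ZMod 2`. -/
noncomputable def symp : LinearMap.BilinForm (ZMod 2) (ι → F4) :=
  LinearMap.mk₂ (ZMod 2) (fun u v => ∑ i, binTrace (u i) (v i))
    (fun a b c => by simp [binTrace, add_mul, Finset.sum_add_distrib])
    (fun r a c => by simp [binTrace, Finset.mul_sum])
    (fun a b c => by simp [binTrace, add_sq, mul_add, Finset.sum_add_distrib])
    (fun r a c => by
      -- The second argument enters squared; linearity survives because scalars in 𝔽₂ are
      -- idempotent.
      have hr : r ^ 2 = r := by revert r; decide
      simp [binTrace, smul_pow, Finset.mul_sum, hr])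

theorem symp_apply (u v : ι → F4) : symp u v = ∑ i, binTrace (u i) (v i) := rfl

theorem algebraMap_symp (u v : ι → F4) :
    algebraMap (ZMod 2) F4 (symp u v) = traceInner u v := by
  simp [symp_apply, traceInner, algebraMap_binTrace]

theorem symp_eq_iff {u v : ι → F4} {r : ZMod 2} :
    symp u v = r ↔ traceInner u v = algebraMap (ZMod 2) F4 r := by
  rw [← algebraMap_symp, (algebraMap (ZMod 2) F4).injective.eq_iff]

theorem symp_eq_zero_iff {u v : ι → F4} : symp u v = 0 ↔ traceInner u v = 0 := by
  rw [symp_eq_iff, map_zero]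

theorem binTrace_comm (x y : F4) : binTrace x y = binTrace y x := by
  apply (algebraMap (ZMod 2) F4).injective
  rw [algebraMap_binTrace, algebraMap_binTrace, traceForm, traceForm]; ring

theorem binTrace_self (x : F4) : binTrace x x = 0 := by
  apply (algebraMap (ZMod 2) F4).injective
  rw [algebraMap_binTrace, traceForm, map_zero]
  linear_combination x ^ 3 * two_eq_zero

theorem symp_comm (u v : ι → F4) : symp u v = symp v u := by
  simp only [symp_apply, binTrace_comm]

theorem symp_self (u : ι → F4) : symp u u = 0 := by
  simp [symp_apply, binTrace_self]

theorem symp_single [DecidableEq ι] (u : ι → F4) (i : ι) (z : F4) :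
    symp u (Pi.single i z) = binTrace (u i) z := by
  rw [symp_apply, Finset.sum_eq_single i]
  · simp
  · intro j _ hj
    simp [hj, binTrace]
  · simp

theorem binTrace_omega_omega_sq : binTrace omega (omega ^ 2) = 1 := by
  apply (algebraMap (ZMod 2) F4).injective
  rw [algebraMap_binTrace, traceForm, map_one]
  linear_combination (omega + 1) * F4_pow_four omega + omega_sq + omega * two_eq_zero

/-- Every element of `𝔽₄` equals `⟨x, ω̄⟩ ω + ⟨x, ω⟩ ω̄`. -/
theorem binTrace_smul_add (x : F4) :
    binTrace x (omega ^ 2) • omega + binTrace x omega • omega ^ 2 = x := by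
  rw [Algebra.smul_def, Algebra.smul_def, algebraMap_binTrace, algebraMap_binTrace, traceForm,
    traceForm]
  linear_combination x * ((omega + 1) * F4_pow_four omega + omega_sq + omega * two_eq_zero)
    + x ^ 2 * omega ^ 3 * two_eq_zero

/-- Words supported at one coordinate, with value ω or ω̄, recover that entry of u through
`binTrace_smul_add`. -/
theorem symp_nondegenerate : (symp : LinearMap.BilinForm (ZMod 2) (ι → F4)).Nondegenerate := by
  classical
  have key : ∀ u : ι → F4, (∀ v, symp u v = 0) → u = 0 := by
    intro u hu
    funext i
    have h : ∀ z, binTrace (u i) z = 0 := fun z => by rw [← symp_single]; exact hu _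
    rw [← binTrace_smul_add (u i), h, h]; simp
  exact ⟨key, fun v hv => key v fun u => by rw [symp_comm]; exact hv u⟩

theorem exists_symp_ne_zero {u : ι → F4} (hu : u ≠ 0) : ∃ v, symp u v = 1 := by
  by_contra! h
  refine hu (symp_nondegenerate.1 u fun v => ?_)
  have h2 : ∀ r : ZMod 2, r ≠ 1 → r = 0 := by decide
  exact h2 _ (h v)

theorem mem_traceDual {C : AddSubgroup (ι → F4)} {u : ι → F4} :
    u ∈ traceDual C ↔ ∀ v ∈ C, symp u v = 0 := by
  simp only [symp_eq_zero_iff]; rfl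

theorem le_traceDual_iff {C : AddSubgroup (ι → F4)} :
    C ≤ traceDual C ↔ ∀ u ∈ C, ∀ v ∈ C, symp u v = 0 :=
  forall₂_congr fun _ _ => mem_traceDual

theorem traceDual_anti {C D : AddSubgroup (ι → F4)} (h : C ≤ D) : traceDual D ≤ traceDual C :=
  fun _ hu => mem_traceDual.2 fun v hv => mem_traceDual.1 hu v (h hv)

theorem natCard_pi_F4 : Nat.card (ι → F4) = 4 ^ Fintype.card ι := by
  rw [Nat.card_fun, natCard_F4, Nat.card_eq_fintype_card]

/-- An additive code is an 𝔽₂-subspace and its trace-dual is the orthogonal complement for a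
nondegenerate form, so the dimensions add up. -/
theorem natCard_mul_natCard_traceDual (C : AddSubgroup (ι → F4)) :
    Nat.card C * Nat.card (traceDual C) = 4 ^ Fintype.card ι := by
  have hD : AddSubgroup.toZModSubmodule 2 (traceDual C)
      = symp.orthogonal (AddSubgroup.toZModSubmodule 2 C) := by
    ext u
    rw [AddSubgroup.mem_toZModSubmodule, mem_traceDual, LinearMap.BilinForm.mem_orthogonal_iff]
    refine forall₂_congr fun v _ => ?_
    rw [symp_comm]
  have h1 (E : AddSubgroup (ι → F4)) :
      Nat.card E = 2 ^ Module.finrank (ZMod 2) (AddSubgroup.toZModSubmodule 2 E) :=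
    (Module.natCard_eq_pow_finrank (K := ZMod 2) (V := AddSubgroup.toZModSubmodule 2 E)).trans
      (by rw [Nat.card_zmod])
  have h3 : Nat.card (ι → F4) = 2 ^ Module.finrank (ZMod 2) (ι → F4) :=
    (Module.natCard_eq_pow_finrank (K := ZMod 2)).trans (by rw [Nat.card_zmod])
  rw [← natCard_pi_F4, h1, h1, h3, ← pow_add, hD, LinearMap.BilinForm.finrank_orthogonal
    symp_nondegenerate, Nat.add_sub_cancel' (Submodule.finrank_le _)]

/-! ### Orthonormal bases over the field with two elements -/

section Orthonormal

variable {V : Type*} [AddCommGroup V] [Module (ZMod 2) V]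

theorem zmod_two_eq_one {r : ZMod 2} (h : r ≠ 0) : r = 1 := by
  revert r; decide

/-- An orthonormal family is linearly independent. -/
theorem linearIndependent_of_orthonormal (B : LinearMap.BilinForm (ZMod 2) V) {r : ℕ}
    {v : Fin r → V} (hv : ∀ i j, B (v i) (v j) = if i = j then 1 else 0) :
    LinearIndependent (ZMod 2) v := by
  rw [Fintype.linearIndependent_iff]
  intro c hc i
  have h := congrArg (B (v i)) hc
  simpa [map_sum, hv] using h

/-- A nonempty orthonormal family that does not span can be replaced by a larger one. -/
theorem exists_orthonormal_succ [FiniteDimensional (ZMod 2) V]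
    (B : LinearMap.BilinForm (ZMod 2) V) (hB : B.Nondegenerate) (hs : ∀ x y, B x y = B y x)
    {r : ℕ} {v : Fin (r + 1) → V} (hv : ∀ i j, B (v i) (v j) = if i = j then 1 else 0)
    (hr : r + 1 < Module.finrank (ZMod 2) V) :
    ∃ w : Fin (r + 2) → V, ∀ i j, B (w i) (w j) = if i = j then 1 else 0 := by
  have hproj : ∀ z, ∀ j, B (v j) (z - ∑ i, B (v i) z • v i) = 0 := by
    intro z j
    simp [map_sum, hv]
  obtain ⟨x, hx0, hx⟩ : ∃ x, x ≠ 0 ∧ ∀ j, B (v j) x = 0 := by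
    by_contra! hcon
    have hspan : Submodule.span (ZMod 2) (Set.range v) = ⊤ := by
      rw [eq_top_iff]
      intro z _
      have h0 : z - ∑ i, B (v i) z • v i = 0 := by
        by_contra h
        obtain ⟨j, hj⟩ := hcon _ h
        exact hj (hproj z j)
      rw [sub_eq_zero.1 h0]
      exact Submodule.sum_mem _ fun i _ =>
        Submodule.smul_mem _ _ (Submodule.subset_span ⟨i, rfl⟩)
    have h1 := finrank_range_le_card (R := ZMod 2) v
    rw [Set.finrank, hspan, finrank_top, Fintype.card_fin] at h1
    omega
  -- A vector with B x x = 1 orthogonal to the family can simply be adjoined.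
  by_cases hxx : ∃ x, (∀ j, B (v j) x = 0) ∧ B x x ≠ 0
  · obtain ⟨x, hx, hxx⟩ := hxx
    have h1 := zmod_two_eq_one hxx
    refine ⟨Fin.cons x v, fun i j => ?_⟩
    refine Fin.cases ?_ (fun i => ?_) i <;> refine Fin.cases ?_ (fun j => ?_) j
    · simp [h1]
    · simp [hs x, hx, (Fin.succ_ne_zero j).symm]
    · simp [hx, Fin.succ_ne_zero]
    · simp [hv]
  -- Now the form is alternating on the complement of the family. A pair x, y there with B x y = 1
  -- lets v₀ be traded for the two orthonormal vectors v₀ + x and v₀ + y.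
  · push Not at hxx
    obtain ⟨z, hz⟩ : ∃ z, B x z ≠ 0 := by
      by_contra! h
      exact hx0 (hB.1 x h)
    set y := z - ∑ i, B (v i) z • v i with hy
    have hyv : ∀ j, B (v j) y = 0 := hproj z
    have hxy : B x y = 1 := by
      have : B x y = B x z := by
        simp [hy, map_sum, hs x, hx]
      rw [this]; exact zmod_two_eq_one hz
    have h2 : (1 : ZMod 2) + 1 = 0 := by decide
    have hxx' := hxx x hx
    have hyy := hxx y hyv
    refine ⟨Fin.cons (v 0 + x) (Fin.cons (v 0 + y) fun i => v i.succ), fun i j => ?_⟩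
    refine Fin.cases ?_ (fun i => Fin.cases ?_ (fun i => ?_) i) i <;>
      refine Fin.cases ?_ (fun j => Fin.cases ?_ (fun j => ?_) j) j <;>
      simp [hv, hx, hyv, hs x (v _), hs y (v _), hs y x, hxy, hxx', hyy, h2, Fin.ext_iff]

/-- A nondegenerate symmetric form over `𝔽₂` that is not alternating has an orthonormal basis. -/
theorem exists_orthonormal_basis [FiniteDimensional (ZMod 2) V]
    (B : LinearMap.BilinForm (ZMod 2) V) (hB : B.Nondegenerate) (hs : ∀ x y, B x y = B y x)
    (hna : ∃ x, B x x ≠ 0) {n : ℕ} (hn : Module.finrank (ZMod 2) V = n) :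
    ∃ b : Module.Basis (Fin n) (ZMod 2) V, ∀ i j, B (b i) (b j) = if i = j then 1 else 0 := by
  obtain ⟨x, hx⟩ := hna
  have hn0 : n ≠ 0 := by
    rintro rfl
    have := Module.finrank_zero_iff.1 hn
    rw [Subsingleton.elim x 0] at hx
    simp at hx
  have key : ∀ r, r + 1 ≤ n →
      ∃ v : Fin (r + 1) → V, ∀ i j, B (v i) (v j) = if i = j then 1 else 0 := by
    intro r
    induction r with
    | zero => exact fun _ => ⟨fun _ => x, fun i j => by
        have hij : i = j := Fin.ext (by omega)
        simp [zmod_two_eq_one hx, hij]⟩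
    | succ r ih =>
      intro h
      obtain ⟨v, hv⟩ := ih (by omega)
      exact exists_orthonormal_succ B hB hs hv (by omega)
  obtain ⟨r, rfl⟩ := Nat.exists_eq_succ_of_ne_zero hn0
  obtain ⟨v, hv⟩ := key r le_rfl
  refine ⟨basisOfLinearIndependentOfCardEqFinrank (linearIndependent_of_orthonormal B hv)
    (by simp [hn]), fun i j => ?_⟩
  simp [hv]

end Orthonormal

/-- The field with `2 ^ m` elements has a trace-self-dual basis over `𝔽₂`. -/
theorem exists_selfDual_basis {m : ℕ} (hm : m ≠ 0) :
    ∃ b : Module.Basis (Fin m) (ZMod 2) (GaloisField 2 m), ∀ i j,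
      Algebra.trace (ZMod 2) (GaloisField 2 m) (b i * b j) = if i = j then 1 else 0 := by
  refine exists_orthonormal_basis (Algebra.traceForm (ZMod 2) (GaloisField 2 m))
    (traceForm_nondegenerate _ _) (fun x y => by simp [Algebra.traceForm_apply, mul_comm]) ?_
    (GaloisField.finrank 2 hm)
  -- Every element is a square in characteristic 2, so an alternating trace form would force the
  -- trace itself to vanish.
  by_contra! h
  refine one_ne_zero (α := GaloisField 2 m) ((traceForm_nondegenerate (ZMod 2) _).1 1 fun z => ?_)
  obtain ⟨y, rfl⟩ := FiniteField.isSquare_of_char_two (ringChar.eq (GaloisField 2 m) 2) z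
  simpa [Algebra.traceForm_apply] using h y

/-! ### Reed–Solomon codes -/

section ReedSolomon

variable {F : Type*} [Field F] {α : F} {n : ℕ}

theorem sum_pow_mul_eq_zero (hα : IsPrimitiveRoot α n) {e : ℕ} (he : ¬ n ∣ e) :
    ∑ l : Fin n, α ^ ((l : ℕ) * e) = 0 := by
  have h1 : α ^ e ≠ 1 := fun h => he ((hα.pow_eq_one_iff_dvd e).1 h)
  have h2 : (∑ l ∈ Finset.range n, (α ^ e) ^ l) * (α ^ e - 1) = 0 := by
    rw [geom_sum_mul, ← pow_mul, mul_comm, pow_mul, hα.pow_eq_one, one_pow, sub_self]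
  rw [Fin.sum_univ_eq_sum_range (fun l => α ^ (l * e))]
  simpa only [← pow_mul, mul_comm e, mul_eq_zero, sub_ne_zero.2 h1, or_false] using h2

/-- The roots αʲ with j < r ≤ n are distinct, so the linear factors are coprime and divisibility
means vanishing at each root. -/
theorem mem_reedSolomon_iff (hα : IsPrimitiveRoot α n) {r : ℕ} (hr : r ≤ n) {c : Fin n → F} :
    c ∈ reedSolomon α n (r + 1) ↔ ∀ j < r, ∑ l, c l * α ^ ((l : ℕ) * j) = 0 := by
  have heval (j : ℕ) : Polynomial.eval (α ^ j)
      (∑ i : Fin n, Polynomial.C (c i) * Polynomial.X ^ (i : ℕ))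
        = ∑ l, c l * α ^ ((l : ℕ) * j) := by
    simp [Polynomial.eval_finsetSum, ← pow_mul, mul_comm j]
  have hmem (d : ℕ) : c ∈ reedSolomon α n d ↔
      (∏ i ∈ Finset.range (d - 1), (Polynomial.X - Polynomial.C (α ^ i))) ∣
        ∑ i : Fin n, Polynomial.C (c i) * Polynomial.X ^ (i : ℕ) := Iff.rfl
  rw [hmem, Nat.add_sub_cancel]
  constructor
  · intro h j hj
    rw [← heval]
    have h1 := (Finset.dvd_prod_of_mem (fun i => Polynomial.X - Polynomial.C (α ^ i))
      (Finset.mem_range.2 hj)).trans h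
    exact (Polynomial.dvd_iff_isRoot.1 h1).eq_zero
  · intro h
    refine Finset.prod_dvd_of_coprime (fun i hi j hj hij => ?_) fun j hj => ?_
    · refine Polynomial.isCoprime_X_sub_C_of_isUnit_sub (sub_ne_zero.2 fun he => hij ?_).isUnit
      simp only [Finset.coe_range, Set.mem_Iio] at hi hj
      exact hα.pow_inj (hi.trans_le hr) (hj.trans_le hr) he
    · rw [Polynomial.dvd_iff_isRoot, Polynomial.IsRoot, heval]
      exact h j (Finset.mem_range.1 hj)

/-- The word with entries `∑ₜ fₜ α^{l(t+1)}`. -/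
def rsWord (α : F) (n : ℕ) {k : ℕ} (f : Fin k → F) (l : Fin n) : F :=
  ∑ t, f t * α ^ ((l : ℕ) * (t + 1))

theorem sum_rsWord_mul {k : ℕ} (f : Fin k → F) (e : ℕ) :
    ∑ l, rsWord α n f l * α ^ ((l : ℕ) * e)
      = ∑ t, f t * ∑ l : Fin n, α ^ ((l : ℕ) * (t + 1 + e)) := by
  simp only [rsWord, Finset.sum_mul, Finset.mul_sum]
  rw [Finset.sum_comm]
  refine Finset.sum_congr rfl fun t _ => Finset.sum_congr rfl fun l _ => ?_
  rw [mul_assoc, ← pow_add, ← mul_add]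

/-- For t < k and j < n - k the exponent t + 1 + j lies strictly between 0 and n, so each power sum
vanishes. This is why the exponents of `rsWord` start at 1. -/
theorem rsWord_mem (hα : IsPrimitiveRoot α n) {k : ℕ} (hk : k < n) (f : Fin k → F) :
    rsWord α n f ∈ reedSolomon α n (n - k + 1) := by
  rw [mem_reedSolomon_iff hα (Nat.sub_le _ _)]
  intro j hj
  rw [sum_rsWord_mul]
  refine Finset.sum_eq_zero fun t _ => ?_
  rw [sum_pow_mul_eq_zero hα, mul_zero]
  have := t.2
  exact Nat.not_dvd_of_pos_of_lt (by omega) (by omega)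

theorem natCast_ne_zero_of_isPrimitiveRoot (hα : IsPrimitiveRoot α n) (hn : n ≠ 0) :
    (n : F) ≠ 0 := by
  have : NeZero n := ⟨hn⟩
  exact hα.neZero'.out

/-- Pairing with the powers of exponent n - (s + 1) isolates the coefficient f s, up to the factor
n, which is invertible in F. -/
theorem rsWord_injective (hα : IsPrimitiveRoot α n) {k : ℕ} (hk : k < n) :
    Function.Injective (rsWord α n : (Fin k → F) → Fin n → F) := by
  intro f f' hff
  have hn := natCast_ne_zero_of_isPrimitiveRoot hα (by omega)
  have key (g : Fin k → F) (s : Fin k) :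
      ∑ l, rsWord α n g l * α ^ ((l : ℕ) * (n - (s + 1))) = g s * n := by
    rw [sum_rsWord_mul, Finset.sum_eq_single s]
    · have hs : (s : ℕ) + 1 + (n - (s + 1)) = n := by omega
      simp only [hs, mul_comm _ n, pow_mul, hα.pow_eq_one, one_pow]
      simp
    · intro t _ hts
      rw [sum_pow_mul_eq_zero hα, mul_zero]
      have hne : (t : ℕ) ≠ s := fun h => hts (Fin.ext h)
      -- The exponent lies strictly between 0 and 2n, so the only multiple of n it could be is n
      -- itself, which means t = s.
      rintro ⟨q, hq⟩
      have h1 : q = 1 := by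
        have h2 : n * q < n * 2 := by omega
        have h3 : n * 0 < n * q := by omega
        have := lt_of_mul_lt_mul_left h2 (Nat.zero_le n)
        have := lt_of_mul_lt_mul_left h3 (Nat.zero_le n)
        omega
      subst h1
      omega
    · simp
  funext s
  exact mul_right_cancel₀ hn (by rw [← key, ← key, hff])

/-- Fourier inversion: the parity checks say that the transform `g` of c vanishes at 0 and on k < e
< n, so only the frequencies 1, …, k remain. -/
theorem exists_rsWord (hα : IsPrimitiveRoot α n) {k : ℕ} (hk : k < n) {c : Fin n → F}
    (hc : c ∈ reedSolomon α n (n - k + 1)) : ∃ f : Fin k → F, rsWord α n f = c := by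
  have hn := natCast_ne_zero_of_isPrimitiveRoot hα (by omega)
  have hα0 : α ≠ 0 := hα.ne_zero (by omega)
  rw [mem_reedSolomon_iff hα (Nat.sub_le _ _)] at hc
  set g : ℕ → F := fun e => ∑ i : Fin n, c i * (α⁻¹) ^ ((i : ℕ) * e) with hg
  have hg' (e : ℕ) (he : e ≤ n) : g e = ∑ i : Fin n, c i * α ^ ((i : ℕ) * (n - e)) := by
    refine Finset.sum_congr rfl fun i _ => ?_
    congr 1
    rw [inv_pow, eq_comm, ← mul_eq_one_iff_eq_inv₀ (pow_ne_zero _ hα0), ← pow_add, ← mul_add,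
      Nat.sub_add_cancel he, mul_comm, pow_mul, hα.pow_eq_one, one_pow]
  have hg0 : g 0 = 0 := by
    have := hc 0 (by omega)
    simpa [hg] using this
  have hgk (e : ℕ) (h1 : k < e) (h2 : e < n) : g e = 0 := by
    rw [hg' e h2.le]; exact hc _ (by omega)
  have hinv (l : Fin n) : c l * n = ∑ e ∈ Finset.range n, g e * α ^ ((l : ℕ) * e) := by
    simp only [hg, Finset.sum_mul]
    rw [Finset.sum_comm, Finset.sum_eq_single l]
    · have h1 (e : ℕ) : c l * α⁻¹ ^ ((l : ℕ) * e) * α ^ ((l : ℕ) * e) = c l := by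
        rw [mul_assoc, ← mul_pow, inv_mul_cancel₀ hα0, one_pow, mul_one]
      rw [Finset.sum_congr rfl fun e _ => h1 e]
      simp [mul_comm]
    · intro i _ hil
      have h1 (e : ℕ) : c i * α⁻¹ ^ ((i : ℕ) * e) * α ^ ((l : ℕ) * e)
          = c i * (α⁻¹ ^ (i : ℕ) * α ^ (l : ℕ)) ^ e := by
        rw [mul_pow, ← pow_mul, ← pow_mul, mul_assoc]
      simp only [h1, ← Finset.mul_sum]
      have h2 : α⁻¹ ^ (i : ℕ) * α ^ (l : ℕ) ≠ 1 := by
        rw [inv_pow, Ne, inv_mul_eq_one₀ (pow_ne_zero _ hα0)]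
        exact fun h => hil (Fin.ext (hα.pow_inj i.2 l.2 h))
      have h3 := geom_sum_mul (α⁻¹ ^ (i : ℕ) * α ^ (l : ℕ)) n
      rw [mul_pow, ← pow_mul, ← pow_mul, mul_comm _ n, mul_comm _ n, pow_mul, pow_mul,
        inv_pow α n, hα.pow_eq_one, inv_one, one_pow, one_pow, mul_one, sub_self, mul_eq_zero] at h3
      rw [h3.resolve_right (sub_ne_zero.2 h2), mul_zero]
    · simp
  refine ⟨fun t => g (t + 1) / n, funext fun l => ?_⟩
  apply mul_right_cancel₀ hn
  rw [hinv, ← Finset.sum_subset (Finset.range_subset_range.2 (show k + 1 ≤ n from hk)),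
    Finset.sum_range_succ', hg0, zero_mul, add_zero, rsWord, Finset.sum_mul,
    ← Fin.sum_univ_eq_sum_range (fun t => g (t + 1) * α ^ ((l : ℕ) * (t + 1)))]
  · refine Finset.sum_congr rfl fun t _ => ?_
    field_simp
  · intro e he he'
    rw [Finset.mem_range] at he he'
    rw [hgk e (by omega) he, zero_mul]

theorem natCard_reedSolomon (hα : IsPrimitiveRoot α n) {k : ℕ} (hk : k < n) :
    Nat.card (reedSolomon α n (n - k + 1)) = Nat.card F ^ k := by
  have h := Nat.card_congr (Equiv.ofBijective
    (fun f : Fin k → F => (⟨rsWord α n f, rsWord_mem hα hk f⟩ : reedSolomon α n (n - k + 1)))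
    ⟨fun f g h => rsWord_injective hα hk (congrArg Subtype.val h), fun c =>
      (exists_rsWord hα hk c.2).imp fun f hf => Subtype.ext hf⟩)
  rw [← h, Nat.card_fun, Nat.card_eq_fintype_card (α := Fin k), Fintype.card_fin]

/-- The product of two words only involves frequencies between 2 and 2k < n, each of which sums to
zero. -/
theorem reedSolomon_selfOrthogonal (hα : IsPrimitiveRoot α n) {k : ℕ} (hk : 2 * k < n)
    {c c' : Fin n → F} (hc : c ∈ reedSolomon α n (n - k + 1))
    (hc' : c' ∈ reedSolomon α n (n - k + 1)) : ∑ l, c l * c' l = 0 := by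
  obtain ⟨f, rfl⟩ := exists_rsWord hα (by omega) hc
  obtain ⟨f', rfl⟩ := exists_rsWord hα (by omega) hc'
  have h1 (l : Fin n) : rsWord α n f l * rsWord α n f' l
      = ∑ t, f' t * (rsWord α n f l * α ^ ((l : ℕ) * (t + 1))) := by
    rw [rsWord, rsWord, Finset.mul_sum]
    exact Finset.sum_congr rfl fun t _ => by ring
  simp only [h1]
  rw [Finset.sum_comm]
  refine Finset.sum_eq_zero fun t _ => ?_
  rw [← Finset.mul_sum, sum_rsWord_mul, Finset.sum_eq_zero, mul_zero]
  intro s _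
  rw [sum_pow_mul_eq_zero hα, mul_zero]
  exact Nat.not_dvd_of_pos_of_lt (by omega) (by omega)

open Classical in
/-- A nonzero word of the dual of a `k`-dimensional Reed–Solomon code has weight at least
`k + 1`. -/
theorem lt_hammingNorm_of_dual (hα : IsPrimitiveRoot α n) {k : ℕ} (hk : k < n) {x : Fin n → F}
    (hx : x ≠ 0) (h : ∀ c ∈ reedSolomon α n (n - k + 1), ∑ l, x l * c l = 0) :
    k < hammingNorm x := by
  by_contra! hle
  obtain ⟨l₀, hl₀⟩ := Function.ne_iff.1 hx
  have hα0 : α ≠ 0 := hα.ne_zero (by omega)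
  set S : Finset (Fin n) := Finset.univ.filter fun l => x l ≠ 0 with hS
  have hl₀S : l₀ ∈ S := by simpa [hS] using hl₀
  have hSk : S.card ≤ k := hle
  -- The polynomial vanishes at the support of x except at l₀ and has degree below k, so the
  -- codeword with entries αˡ p(αˡ) meets the support of x only in l₀.
  set p : Polynomial F :=
    ∏ l ∈ S.erase l₀, (Polynomial.X - Polynomial.C (α ^ (l : ℕ))) with hp
  have hdeg : p.natDegree < k := by
    rw [hp, Polynomial.natDegree_finsetProd_X_sub_C_eq_card, Finset.card_erase_of_mem hl₀S]
    have := Finset.card_pos.2 ⟨l₀, hl₀S⟩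
    omega
  have hw (l : Fin n) : rsWord α n (fun t : Fin k => p.coeff t) l
      = α ^ (l : ℕ) * p.eval (α ^ (l : ℕ)) := by
    rw [rsWord, Polynomial.eval_eq_sum_range' hdeg, Finset.mul_sum,
      Fin.sum_univ_eq_sum_range (fun t => p.coeff t * α ^ ((l : ℕ) * (t + 1)))]
    refine Finset.sum_congr rfl fun t _ => ?_
    rw [← pow_mul]; ring
  have h0 := h _ (rsWord_mem hα hk fun t : Fin k => p.coeff t)
  simp only [hw] at h0
  rw [Finset.sum_eq_single l₀] at h0
  · have hev : p.eval (α ^ (l₀ : ℕ)) ≠ 0 := by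
      rw [hp, Polynomial.eval_prod, Finset.prod_ne_zero_iff]
      intro l hl
      simp only [Polynomial.eval_sub, Polynomial.eval_X, Polynomial.eval_C]
      exact sub_ne_zero.2 fun he => Finset.ne_of_mem_erase hl
        (Fin.ext (hα.pow_inj l₀.2 l.2 he)).symm
    exact mul_ne_zero hl₀ (mul_ne_zero (pow_ne_zero _ hα0) hev) h0
  · intro l _ hl
    by_cases hxl : x l = 0
    · rw [hxl, zero_mul]
    · have : p.eval (α ^ (l : ℕ)) = 0 := by
        rw [hp, Polynomial.eval_prod]
        exact Finset.prod_eq_zero (Finset.mem_erase.2 ⟨hl, by simpa [hS] using hxl⟩) (by simp)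
      rw [this, mul_zero, mul_zero]
  · simp

end ReedSolomon

/-! ### Quantum Reed–Solomon codes -/

section Lift

/-- The word `ω x + ω̄ y`. -/
noncomputable def quatWord {ι : Type*} (x y : ι → ZMod 2) : ι → F4 := fun i =>
  omega * algebraMap (ZMod 2) F4 (x i) + omega ^ 2 * algebraMap (ZMod 2) F4 (y i)

theorem quatWord_eq {ι : Type*} (x y : ι → ZMod 2) (i : ι) :
    quatWord x y i = x i • omega + y i • omega ^ 2 := by
  simp only [quatWord, Algebra.smul_def, mul_comm]

theorem quatWord_binTrace {ι : Type*} (u : ι → F4) :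
    quatWord (fun i => binTrace (u i) (omega ^ 2)) (fun i => binTrace (u i) omega) = u := by
  funext i
  rw [quatWord_eq, binTrace_smul_add]

theorem binTrace_add_left (x y z : F4) : binTrace (x + y) z = binTrace x z + binTrace y z := by
  simp [binTrace, add_mul]

theorem binTrace_add_right (x y z : F4) : binTrace x (y + z) = binTrace x y + binTrace x z := by
  rw [binTrace_comm, binTrace_add_left, binTrace_comm y, binTrace_comm z]

theorem binTrace_smul_left (r : ZMod 2) (x y : F4) : binTrace (r • x) y = r * binTrace x y := by
  simp [binTrace]

theorem binTrace_smul_right (r : ZMod 2) (x y : F4) : binTrace x (r • y) = r * binTrace x y := by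
  rw [binTrace_comm, binTrace_smul_left, binTrace_comm]

theorem binTrace_quat (a b c d : ZMod 2) :
    binTrace (a • omega + b • omega ^ 2) (c • omega + d • omega ^ 2) = a * d + b * c := by
  simp only [binTrace_add_left, binTrace_add_right, binTrace_smul_left, binTrace_smul_right,
    binTrace_self, binTrace_omega_omega_sq, binTrace_comm (omega ^ 2) omega]
  ring

theorem quatWord_injective {ι : Type*} {x y x' y' : ι → ZMod 2}
    (h : quatWord x y = quatWord x' y') : x = x' ∧ y = y' := by
  have h1 (i : ι) := congrFun h i
  simp only [quatWord_eq] at h1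
  constructor <;> funext i
  · have := congrArg (fun z => binTrace z (0 • omega + (1 : ZMod 2) • omega ^ 2)) (h1 i)
    have h0 : (0 : ℕ) • omega = (0 : ZMod 2) • omega := by simp
    simpa only [h0, binTrace_quat, mul_one, mul_zero, add_zero] using this
  · have := congrArg (fun z => binTrace z ((1 : ZMod 2) • omega + (0 : ZMod 2) • omega ^ 2)) (h1 i)
    simpa only [binTrace_quat, mul_one, mul_zero, zero_add] using this

variable {ι : Type*} [Fintype ι]

theorem symp_quatWord (x y x' y' : ι → ZMod 2) :
    symp (quatWord x y) (quatWord x' y') = ∑ i, (x i * y' i + y i * x' i) := by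
  simp only [symp_apply, quatWord_eq, binTrace_quat]

theorem mem_quaternaryLift {ι : Type*} {D : AddSubgroup (ι → ZMod 2)} {u : ι → F4} :
    u ∈ quaternaryLift D ↔ ∃ x ∈ D, ∃ y ∈ D, u = quatWord x y := Iff.rfl

theorem natCard_quaternaryLift {ι : Type*} (D : AddSubgroup (ι → ZMod 2)) :
    Nat.card (quaternaryLift D) = Nat.card D ^ 2 := by
  rw [sq, ← Nat.card_prod]
  refine (Nat.card_congr (Equiv.ofBijective (fun p : D × D =>
    (⟨quatWord p.1 p.2, p.1, p.1.2, p.2, p.2.2, rfl⟩ : quaternaryLift D)) ⟨?_, ?_⟩)).symm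
  · intro p q h
    obtain ⟨h1, h2⟩ := quatWord_injective (congrArg Subtype.val h)
    exact Prod.ext (Subtype.ext h1) (Subtype.ext h2)
  · rintro ⟨u, hu⟩
    obtain ⟨x, hx, y, hy, rfl⟩ := mem_quaternaryLift.1 hu
    exact ⟨(⟨x, hx⟩, ⟨y, hy⟩), rfl⟩

theorem quaternaryLift_selfOrthogonal {D : AddSubgroup (ι → ZMod 2)}
    (hD : ∀ x ∈ D, ∀ y ∈ D, ∑ i, x i * y i = 0) :
    quaternaryLift D ≤ traceDual (quaternaryLift D) := by
  rw [le_traceDual_iff]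
  rintro u hu v hv
  obtain ⟨x, hx, y, hy, rfl⟩ := mem_quaternaryLift.1 hu
  obtain ⟨x', hx', y', hy', rfl⟩ := mem_quaternaryLift.1 hv
  rw [symp_quatWord, Finset.sum_add_distrib, hD x hx y' hy', hD y hy x' hx', add_zero]

/-- Testing against ω̄ z and ω z separates the two binary components. -/
theorem dual_of_mem_traceDual_quaternaryLift {D : AddSubgroup (ι → ZMod 2)} {x y : ι → ZMod 2}
    (h : quatWord x y ∈ traceDual (quaternaryLift D)) :
    (∀ z ∈ D, ∑ i, x i * z i = 0) ∧ ∀ z ∈ D, ∑ i, y i * z i = 0 := by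
  rw [mem_traceDual] at h
  refine ⟨fun z hz => ?_, fun z hz => ?_⟩
  · simpa [symp_quatWord] using h (quatWord 0 z) ⟨0, D.zero_mem, z, hz, rfl⟩
  · simpa [symp_quatWord] using h (quatWord z 0) ⟨z, hz, 0, D.zero_mem, rfl⟩

end Lift

section Expansion

variable {F : Type*} [Field F] [Algebra (ZMod 2) F] {n m : ℕ}

/-- The word over `F` with a given binary expansion in the basis `b`. -/
noncomputable def collapse (b : Module.Basis (Fin m) (ZMod 2) F) :
    (Fin n × Fin m → ZMod 2) ≃ (Fin n → F) :=
  (Equiv.curry (Fin n) (Fin m) (ZMod 2)).trans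
    (Equiv.piCongrRight fun _ => b.equivFun.symm.toEquiv)

theorem collapse_apply (b : Module.Basis (Fin m) (ZMod 2) F) (x : Fin n × Fin m → ZMod 2)
    (i : Fin n) : collapse b x i = ∑ j, x (i, j) • b j := by
  simp [collapse, Module.Basis.equivFun_symm_apply, Function.curry]

theorem collapse_apply_eq_zero_iff (b : Module.Basis (Fin m) (ZMod 2) F)
    (x : Fin n × Fin m → ZMod 2) (i : Fin n) : collapse b x i = 0 ↔ ∀ j, x (i, j) = 0 := by
  rw [collapse_apply]
  exact ⟨fun h => Fintype.linearIndependent_iff.1 b.linearIndependent _ h, fun h => by simp [h]⟩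

theorem mem_binaryExpansion {b : Module.Basis (Fin m) (ZMod 2) F} {C : Submodule F (Fin n → F)}
    {x : Fin n × Fin m → ZMod 2} : x ∈ binaryExpansion b C ↔ collapse b x ∈ C := by
  have : collapse b x = fun i => ∑ j, x (i, j) • b j := funext fun i => collapse_apply b x i
  rw [this]; rfl

theorem natCard_binaryExpansion (b : Module.Basis (Fin m) (ZMod 2) F)
    (C : Submodule F (Fin n → F)) : Nat.card (binaryExpansion b C) = Nat.card C :=
  Nat.card_congr ((collapse b).subtypeEquiv fun _ => mem_binaryExpansion)

theorem trace_sum_collapse {b : Module.Basis (Fin m) (ZMod 2) F}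
    (hb : ∀ i j, Algebra.trace (ZMod 2) F (b i * b j) = if i = j then 1 else 0)
    (x y : Fin n × Fin m → ZMod 2) :
    Algebra.trace (ZMod 2) F (∑ i, collapse b x i * collapse b y i) = ∑ p, x p * y p := by
  simp only [collapse_apply, map_sum, Finset.sum_mul_sum, smul_mul_smul_comm, map_smul, hb,
    Fintype.sum_prod_type]
  simp

/-- C is linear over F, so binary orthogonality gives Tr(r ∑ xᵢ cᵢ) = 0 for every r in F, and the
trace form is nondegenerate. -/
theorem binaryExpansion_dual [Finite F] {b : Module.Basis (Fin m) (ZMod 2) F}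
    (hb : ∀ i j, Algebra.trace (ZMod 2) F (b i * b j) = if i = j then 1 else 0)
    {C : Submodule F (Fin n → F)} {x : Fin n × Fin m → ZMod 2}
    (h : ∀ y ∈ binaryExpansion b C, ∑ p, x p * y p = 0) {c : Fin n → F} (hc : c ∈ C) :
    ∑ i, collapse b x i * c i = 0 := by
  refine (traceForm_nondegenerate (ZMod 2) F).1 _ fun r => ?_
  have hy : collapse b ((collapse b).symm (r • c)) = r • c := (collapse b).apply_symm_apply _
  have h1 := trace_sum_collapse hb x ((collapse b).symm (r • c))
  rw [h _ (mem_binaryExpansion.2 (by rw [hy]; exact C.smul_mem r hc)), hy] at h1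
  rw [Algebra.traceForm_apply, ← h1, Finset.sum_mul]
  exact congrArg _ (Finset.sum_congr rfl fun i _ => by rw [Pi.smul_apply, smul_eq_mul]; ring)

end Expansion

section QuantumReedSolomon

variable {m k : ℕ} {B : AddSubgroup (Fin (2 ^ m - 1) × Fin m → F4)}

theorem two_mul_lt_of_le {m k : ℕ} (h1 : 1 ≤ k) (h2 : k ≤ 2 ^ (m - 1) - 1) :
    m ≠ 0 ∧ 2 * k < 2 ^ m - 1 := by
  have hm : m ≠ 0 := by
    rintro rfl
    simp at h2; omega
  obtain ⟨r, rfl⟩ := Nat.exists_eq_succ_of_ne_zero hm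
  rw [Nat.succ_eq_add_one, Nat.add_sub_cancel] at h2
  rw [Nat.succ_eq_add_one, pow_succ]
  omega

theorem IsQuantumReedSolomon.selfOrthogonal (h : IsQuantumReedSolomon m k B) :
    B ≤ traceDual B := by
  obtain ⟨h1, h2, α, hα, b, hb, rfl⟩ := h
  refine quaternaryLift_selfOrthogonal fun x hx y hy => ?_
  rw [← trace_sum_collapse hb, reedSolomon_selfOrthogonal hα (two_mul_lt_of_le h1 h2).2
    (mem_binaryExpansion.1 hx) (mem_binaryExpansion.1 hy), map_zero]

theorem IsQuantumReedSolomon.natCard_eq (h : IsQuantumReedSolomon m k B) :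
    Nat.card B = 2 ^ (2 * (m * k)) := by
  obtain ⟨h1, h2, α, hα, b, hb, rfl⟩ := h
  obtain ⟨hm, hk⟩ := two_mul_lt_of_le h1 h2
  rw [natCard_quaternaryLift, natCard_binaryExpansion, natCard_reedSolomon hα (by omega),
    GaloisField.card 2 m hm, ← pow_mul, ← pow_mul, mul_comm 2, mul_assoc]

open Classical in
/-- A nonzero word of the dual of a quantum Reed–Solomon code has more than `k` nonzero
blocks. -/
theorem IsQuantumReedSolomon.lt_card_blocks (h : IsQuantumReedSolomon m k B)
    {u : Fin (2 ^ m - 1) × Fin m → F4} (hu : u ∈ traceDual B) (hu0 : u ≠ 0) :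
    k < (Finset.univ.filter fun l => ∃ a, u (l, a) ≠ 0).card := by
  obtain ⟨h1, h2, α, hα, b, hb, rfl⟩ := h
  obtain ⟨hm, hk⟩ := two_mul_lt_of_le h1 h2
  set x := fun i => binTrace (u i) (omega ^ 2) with hx
  set y := fun i => binTrace (u i) omega with hy
  have hxy : quatWord x y = u := quatWord_binTrace u
  rw [← hxy] at hu
  obtain ⟨dx, dy⟩ := dual_of_mem_traceDual_quaternaryLift hu
  -- Either binary component of u, if nonzero, suffices: its support lies in the nonzero blocks of
  -- u. The bound covers every nonzero dual word, including those in B.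
  have key (z : Fin (2 ^ m - 1) × Fin m → ZMod 2) (hz0 : z ≠ 0) (hzu : ∀ p, u p = 0 → z p = 0)
      (hz : ∀ w ∈ binaryExpansion b (reedSolomon α (2 ^ m - 1) (2 ^ m - 1 - k + 1)),
        ∑ p, z p * w p = 0) :
      k < (Finset.univ.filter fun l => ∃ a, u (l, a) ≠ 0).card := by
    have hc0 : collapse b z ≠ 0 := by
      intro h0
      refine hz0 (funext fun p => ?_)
      exact (collapse_apply_eq_zero_iff b z p.1).1 (congrFun h0 p.1) p.2
    refine (lt_hammingNorm_of_dual hα (by omega) hc0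
      fun c hc => binaryExpansion_dual hb hz hc).trans_le (Finset.card_le_card fun l hl => ?_)
    rw [Finset.mem_filter] at hl ⊢
    refine ⟨hl.1, ?_⟩
    by_contra! hcon
    exact hl.2 ((collapse_apply_eq_zero_iff b z l).2 fun a => hzu _ (hcon a))
  by_cases hx0 : x = 0
  · refine key y (fun hy0 => hu0 ?_) (fun p hp => by simp [hy, hp, binTrace]) dy
    rw [← hxy, hx0, hy0]
    funext i
    simp [quatWord]
  · exact key x hx0 (fun p hp => by simp [hx, hp, binTrace]) dx

theorem exists_isQuantumReedSolomon (h1 : 1 ≤ k) (h2 : k ≤ 2 ^ (m - 1) - 1) :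
    ∃ B, IsQuantumReedSolomon m k B := by
  obtain ⟨hm, hk⟩ := two_mul_lt_of_le h1 h2
  obtain ⟨b, hb⟩ := exists_selfDual_basis hm
  obtain ⟨α, hα⟩ : ∃ α : GaloisField 2 m, IsPrimitiveRoot α (2 ^ m - 1) := by
    obtain ⟨g, hg⟩ := IsCyclic.exists_generator (α := (GaloisField 2 m)ˣ)
    have hord := orderOf_eq_card_of_forall_mem_zpowers hg
    rw [Nat.card_units, GaloisField.card 2 m hm] at hord
    exact ⟨g, IsPrimitiveRoot.coe_units_iff.2 (hord ▸ IsPrimitiveRoot.orderOf g)⟩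
  exact ⟨_, h1, h2, α, hα, b, hb, rfl⟩

end QuantumReedSolomon

/-! ### Generalized concatenated codes -/

theorem symp_prod {κ ι : Type*} [Fintype κ] [Fintype ι] (c c' : κ × ι → F4) :
    symp c c' = ∑ l, symp (fun t => c (l, t)) (fun t => c' (l, t)) := by
  simp only [symp_apply, Fintype.sum_prod_type]

open Classical in
theorem hammingNorm_prod {κ ι : Type*} [Fintype κ] [Fintype ι] (c : κ × ι → F4) :
    hammingNorm c = ∑ l, hammingNorm (fun t => c (l, t)) := by
  simp only [hammingNorm, Finset.card_filter, Fintype.sum_prod_type]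

namespace GCData

variable {s m n₂ : ℕ} (D : GCData s m n₂)

/-- The last of the indices `0, …, s - 1`. -/
def last : Fin s := ⟨s - 1, Nat.sub_lt (lt_of_lt_of_le two_pos D.two_le) one_pos⟩

theorem le_last (j : Fin s) : j ≤ D.last := Fin.le_def.2 (Nat.le_sub_one_of_lt j.2)

theorem lastStab_le (j : Fin s) : D.lastStab ≤ (D.inner j).stab :=
  D.inner_nested _ _ (D.le_last j)

theorem traceDual_inner_mono {i j : Fin s} (h : i ≤ j) :
    traceDual (D.inner i).stab ≤ traceDual (D.inner j).stab :=
  traceDual_anti (D.inner_nested _ _ h)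

theorem symp_g_h (i : Fin s) (a : Fin m) (j : Fin s) (b : Fin m) :
    symp (D.g i a) (D.h j b) = if i = j ∧ a = b then 1 else 0 := by
  rw [symp_eq_iff, D.inner_g_h]; split_ifs <;> simp

theorem symp_g_g (i : Fin s) (a : Fin m) (j : Fin s) (b : Fin m) :
    symp (D.g i a) (D.g j b) = 0 := symp_eq_zero_iff.2 (D.inner_g_g i a j b)

theorem symp_h_h (i : Fin s) (a : Fin m) (j : Fin s) (b : Fin m) :
    symp (D.h i a) (D.h j b) = 0 := symp_eq_zero_iff.2 (D.inner_h_h i a j b)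

theorem rho_apply (x : Fin s → Fin m → F4) :
    D.rho x = ∑ j, ∑ a, (binTrace (x j a) (omega ^ 2) • D.g j a +
      binTrace (x j a) omega • D.h j a) := by
  simp only [← algebraMap_smul_eq, algebraMap_binTrace]; rfl

/-- The coordinates of a word with respect to the vectors `g` and `h`. -/
noncomputable def coords : (Fin n₂ → F4) →+ (Fin s → Fin m → F4) where
  toFun u j a := symp u (D.h j a) • omega + symp u (D.g j a) • omega ^ 2
  map_zero' := by funext j a; simp
  map_add' u v := by funext j a; simp [add_smul]; abel

theorem coords_apply (u : Fin n₂ → F4) (j : Fin s) (a : Fin m) :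
    D.coords u j a = symp u (D.h j a) • omega + symp u (D.g j a) • omega ^ 2 := rfl

/-- `coords` is the adjoint of `rho`; this reduces orthogonality to the concatenated code to
orthogonality to the outer codes. -/
theorem symp_rho (u : Fin n₂ → F4) (x : Fin s → Fin m → F4) :
    symp u (D.rho x) = ∑ j, symp (D.coords u j) (x j) := by
  rw [rho_apply, map_sum]
  refine Finset.sum_congr rfl fun j _ => ?_
  rw [map_sum, symp_apply]
  refine Finset.sum_congr rfl fun a _ => ?_
  conv_rhs => rw [coords_apply, ← binTrace_smul_add (x j a), binTrace_quat]
  simp only [map_add, map_smul, smul_eq_mul]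
  ring

theorem coords_rho (x : Fin s → Fin m → F4) : D.coords (D.rho x) = x := by
  funext j a
  have h1 : symp (D.rho x) (D.h j a) = binTrace (x j a) (omega ^ 2) := by
    rw [rho_apply, map_sum, LinearMap.sum_apply, Finset.sum_eq_single j, map_sum,
      LinearMap.sum_apply, Finset.sum_eq_single a]
    · simp [symp_g_h, symp_h_h]
    · intro b _ hb; simp [symp_g_h, symp_h_h, hb]
    · simp
    · intro i _ hi; simp [symp_g_h, symp_h_h, hi]
    · simp
  have h2 : symp (D.rho x) (D.g j a) = binTrace (x j a) omega := by
    rw [rho_apply, map_sum, LinearMap.sum_apply, Finset.sum_eq_single j, map_sum,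
      LinearMap.sum_apply, Finset.sum_eq_single a]
    · simp [symp_comm (D.h _ _) (D.g _ _), symp_g_h, symp_g_g]
    · intro b _ hb; simp [symp_comm (D.h _ _) (D.g _ _), symp_g_h, symp_g_g, hb.symm]
    · simp
    · intro i _ hi; simp [symp_comm (D.h _ _) (D.g _ _), symp_g_h, symp_g_g, hi.symm]
    · simp
  rw [coords_apply, h1, h2, binTrace_smul_add]

/-- The duals C_j^⊥ increase with j, and only the vectors g_j, h_j with j ≤ i occur. -/
theorem rho_mem {i : Fin s} {x : Fin s → Fin m → F4} (hx : ∀ j, i < j → x j = 0) :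
    D.rho x ∈ traceDual (D.inner i).stab := by
  rw [rho_apply]
  refine sum_mem fun j _ => sum_mem fun a _ => ?_
  rcases lt_or_ge i j with hij | hij
  · simp [hx j hij, binTrace]
  · exact add_mem (ZMod.smul_mem (D.traceDual_inner_mono hij (D.g_mem j a)) _)
      (ZMod.smul_mem (D.traceDual_inner_mono hij (D.h_mem j a)) _)

theorem rho_mem_traceDual_lastStab (x : Fin s → Fin m → F4) :
    D.rho x ∈ traceDual D.lastStab :=
  D.rho_mem (i := D.last) fun j hj => absurd (D.le_last j) (not_le.2 hj)

/-- The j-th coordinates are pairings with g_j and h_j, which lie in C_j^⊥. -/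
theorem coords_eq_zero_of_mem {j : Fin s} {u : Fin n₂ → F4} (hu : u ∈ (D.inner j).stab) :
    D.coords u j = 0 := by
  funext a
  rw [coords_apply, symp_comm, mem_traceDual.1 (D.h_mem j a) u hu, symp_comm,
    mem_traceDual.1 (D.g_mem j a) u hu]
  simp

theorem coords_lastStab {u : Fin n₂ → F4} (hu : u ∈ D.lastStab) : D.coords u = 0 :=
  funext fun j => D.coords_eq_zero_of_mem (D.lastStab_le j hu)

theorem natCard_lastStab : Nat.card D.lastStab * 2 ^ (s * m) = 2 ^ n₂ := by
  have h := D.inner_encodes D.last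
  have h1 : ((D.last : ℕ) + 1) = s := by
    have := D.two_le
    simp only [last]; omega
  rw [h1, QuantumCode.Encodes, Fintype.card_fin] at h
  exact h

/-- The vectors `g`, `h` span `C_s^⊥` modulo `C_s`. -/
theorem mem_lastStab {u : Fin n₂ → F4} (hu : u ∈ traceDual D.lastStab) (h0 : D.coords u = 0) :
    u ∈ D.lastStab := by
  set K := traceDual D.lastStab ⊓ D.coords.ker with hK
  have hle : D.lastStab ≤ K := fun v hv =>
    ⟨(D.inner D.last).selfOrthogonal hv, D.coords_lastStab hv⟩
  -- Subtracting ρ of the coordinates splits C_s^⊥ as K × 𝔽₄^{sm}. Counting then gives |K| = |C_s|,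
  -- so the inclusion of C_s in K is an equality.
  have hcard : Nat.card (K × (Fin s → Fin m → F4)) = Nat.card (traceDual D.lastStab) := by
    refine Nat.card_congr (Equiv.ofBijective (fun p => ⟨p.1 + D.rho p.2,
      add_mem p.1.2.1 (D.rho_mem_traceDual_lastStab p.2)⟩) ⟨?_, ?_⟩)
    · rintro ⟨v, x⟩ ⟨v', x'⟩ h
      have h1 : (v : Fin n₂ → F4) + D.rho x = v' + D.rho x' := congrArg Subtype.val h
      have h2 := congrArg D.coords h1
      rw [map_add, map_add, coords_rho, coords_rho, AddMonoidHom.mem_ker.1 v.2.2,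
        AddMonoidHom.mem_ker.1 v'.2.2, zero_add, zero_add] at h2
      subst h2
      rw [Prod.mk.injEq]
      exact ⟨Subtype.ext (add_right_cancel h1), rfl⟩
    · rintro ⟨v, hv⟩
      have hvK : v - D.rho (D.coords v) ∈ K := by
        refine AddSubgroup.mem_inf.2 ⟨sub_mem hv (D.rho_mem_traceDual_lastStab _), ?_⟩
        rw [AddMonoidHom.mem_ker, map_sub, coords_rho, sub_self]
      exact ⟨(⟨_, hvK⟩, D.coords v), Subtype.ext (sub_add_cancel _ _)⟩
  have h1 := natCard_mul_natCard_traceDual D.lastStab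
  have h2 := D.natCard_lastStab
  rw [Nat.card_prod, Nat.card_fun, Nat.card_fun, natCard_F4, Nat.card_eq_fintype_card (α := Fin m),
    Nat.card_eq_fintype_card (α := Fin s), Fintype.card_fin, Fintype.card_fin] at hcard
  have h3 : Nat.card K = Nat.card D.lastStab := by
    have hpos : 0 < Nat.card D.lastStab := Nat.card_pos
    have h4 : Nat.card D.lastStab * (4 ^ m) ^ s * Nat.card K
        = Nat.card D.lastStab * (4 ^ m) ^ s * Nat.card D.lastStab := by
      rw [mul_assoc, mul_comm _ (Nat.card K), hcard, h1, Fintype.card_fin]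
      have h5 : (4 : ℕ) ^ n₂ = 2 ^ n₂ * 2 ^ n₂ := by rw [← mul_pow]; norm_num
      have h6 : ((4 : ℕ) ^ m) ^ s = 2 ^ (s * m) * 2 ^ (s * m) := by
        rw [← pow_mul, ← mul_pow, mul_comm]; norm_num
      rw [h5, ← h2, h6]; ring
    exact Nat.eq_of_mul_eq_mul_left (by positivity) h4
  rw [AddSubgroup.eq_of_le_of_card_ge hle h3.le]
  exact ⟨hu, h0⟩

/-- The word with blocks `ρ(l-th column of b)`. -/
noncomputable def encode (b : Fin s → (Fin (2 ^ m - 1) × Fin m → F4)) :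
    Fin (2 ^ m - 1) × Fin n₂ → F4 := fun p => D.rho (column b p.1) p.2

theorem symp_encode (c : Fin (2 ^ m - 1) × Fin n₂ → F4)
    (b : Fin s → (Fin (2 ^ m - 1) × Fin m → F4)) :
    symp c (D.encode b)
      = ∑ i, symp (fun p => D.coords (fun t => c (p.1, t)) i p.2) (b i) := by
  rw [symp_prod]
  have h1 (l : Fin (2 ^ m - 1)) : symp (fun t => c (l, t)) (fun t => D.encode b (l, t))
      = ∑ i, symp (D.coords (fun t => c (l, t)) i) (fun a => b i (l, a)) := by
    have h2 : (fun t => D.encode b (l, t)) = D.rho (column b l) := rfl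
    rw [h2, symp_rho]
    rfl
  simp only [h1]
  rw [Finset.sum_comm]
  refine Finset.sum_congr rfl fun i _ => ?_
  rw [symp_prod]

/-- Blocks of code words lie in C_s^⊥, so c' may be changed modulo C_s into its encoded
representative; the pairing becomes the sum of the outer pairings of b_i with b'_i. -/
theorem code_selfOrthogonal : D.code ≤ traceDual D.code := by
  rw [le_traceDual_iff]
  rintro c ⟨b, hb, hc⟩ c' ⟨b', hb', hc'⟩
  have hcoords {c : Fin (2 ^ m - 1) × Fin n₂ → F4} {b : Fin s → (Fin (2 ^ m - 1) × Fin m → F4)}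
      (hc : ∀ l, (fun t => c (l, t)) - D.rho (column b l) ∈ D.lastStab) (l) :
      D.coords (fun t => c (l, t)) = column b l := by
    have := D.coords_lastStab (hc l)
    rwa [map_sub, coords_rho, sub_eq_zero] at this
  have hdual (l) : (fun t => c (l, t)) ∈ traceDual D.lastStab := by
    have h1 := add_mem ((D.inner D.last).selfOrthogonal (hc l))
      (D.rho_mem_traceDual_lastStab (column b l))
    rwa [sub_add_cancel] at h1
  have h1 : symp c c' = symp c (D.encode b') := by
    rw [symp_prod, symp_prod]
    refine Finset.sum_congr rfl fun l _ => ?_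
    have h2 := mem_traceDual.1 (hdual l) _ (hc' l)
    rwa [map_sub, sub_eq_zero] at h2
  rw [h1, symp_encode]
  refine Finset.sum_eq_zero fun i _ => ?_
  simp only [hcoords hc]
  exact mem_traceDual.1 ((D.outer_isRS i).selfOrthogonal (hb i)) _ (hb' i)

/-- The generalized concatenated quantum code. -/
noncomputable def quantumCode : QuantumCode (Fin (2 ^ m - 1) × Fin n₂) where
  stab := D.code
  selfOrthogonal := D.code_selfOrthogonal

/-- The rows b and the C_s-part of each block are chosen freely, and `coords` recovers b from the
word. -/
theorem natCard_code : Nat.card D.code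
    = (∏ i, Nat.card (D.outer i)) * Nat.card D.lastStab ^ (2 ^ m - 1) := by
  have h1 : Nat.card ((∀ i, D.outer i) × (Fin (2 ^ m - 1) → D.lastStab)) = Nat.card D.code := by
    refine Nat.card_congr (Equiv.ofBijective (fun p => ⟨fun q =>
      (p.2 q.1 : Fin n₂ → F4) q.2 + D.encode (fun i => (p.1 i : _ → F4)) q,
      fun i => p.1 i, fun i => (p.1 i).2, fun l => ?_⟩) ⟨?_, ?_⟩)
    · have : (fun t => (p.2 l : Fin n₂ → F4) t + D.encode (fun i => (p.1 i : _ → F4)) (l, t))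
          = (p.2 l : Fin n₂ → F4) + D.rho (column (fun i => (p.1 i : _ → F4)) l) := rfl
      rw [this, add_sub_cancel_right]
      exact (p.2 l).2
    · rintro ⟨b, e⟩ ⟨b', e'⟩ h
      have h2 (l : Fin (2 ^ m - 1)) :
          (e l : Fin n₂ → F4) + D.rho (column (fun i => (b i : _ → F4)) l)
            = e' l + D.rho (column (fun i => (b' i : _ → F4)) l) :=
        funext fun t => congrFun (congrArg Subtype.val h) (l, t)
      have h3 (l) := congrArg D.coords (h2 l)
      simp only [map_add, coords_rho, D.coords_lastStab (e _).2, D.coords_lastStab (e' _).2,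
        zero_add] at h3
      have hb : b = b' := by
        funext i
        refine Subtype.ext (funext fun p => ?_)
        exact congrFun (congrFun (h3 p.1) i) p.2
      subst hb
      rw [Prod.mk.injEq]
      exact ⟨rfl, funext fun l => Subtype.ext (add_right_cancel (h2 l))⟩
    · rintro ⟨c, b, hb, hc⟩
      refine ⟨(fun i => ⟨b i, hb i⟩, fun l => ⟨_, hc l⟩), Subtype.ext (funext fun q => ?_)⟩
      exact sub_add_cancel (c q) (D.rho (column b q.1) q.2)
  rw [← h1, Nat.card_prod, Nat.card_pi, Nat.card_fun, Nat.card_eq_fintype_card (α := Fin _),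
    Fintype.card_fin]

/-- The number of encoded qubits is `m ∑ᵢ (n₁ - 2 kᵢ)`. -/
theorem quantumCode_encodes :
    D.quantumCode.Encodes (∑ i, m * ((2 ^ m - 1) - 2 * D.k i)) := by
  have h1 : Nat.card D.code * 2 ^ (∑ i, m * ((2 ^ m - 1) - 2 * D.k i))
      = (Nat.card D.lastStab * 2 ^ (s * m)) ^ (2 ^ m - 1) := by
    rw [natCard_code, ← Finset.prod_pow_eq_pow_sum, mul_right_comm, ← Finset.prod_mul_distrib,
      mul_comm, mul_pow]
    congr 1
    have h2 (i : Fin s) : Nat.card (D.outer i) * 2 ^ (m * ((2 ^ m - 1) - 2 * D.k i))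
        = 2 ^ (m * (2 ^ m - 1)) := by
      have hk := (two_mul_lt_of_le (D.outer_isRS i).1 (D.outer_isRS i).2.1).2
      rw [(D.outer_isRS i).natCard_eq, ← pow_add, mul_left_comm, ← mul_add,
        Nat.add_sub_cancel' hk.le]
    rw [Finset.prod_congr rfl fun i _ => h2 i, Finset.prod_const, Finset.card_univ,
      Fintype.card_fin, ← pow_mul, ← pow_mul]
    congr 1; ring
  rw [QuantumCode.Encodes, Fintype.card_prod, Fintype.card_fin, Fintype.card_fin]
  change Nat.card D.code * _ = _
  rw [h1, natCard_lastStab, ← pow_mul, mul_comm]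

open Classical in
/-- A generalized concatenated code has minimum distance at least `minᵢ (kᵢ + 1) wᵢ` if the
inner codes have minimum distances at least `wᵢ`. -/
theorem exists_le_hammingNorm {w : Fin s → ℕ}
    (hw : ∀ i, ∀ u ∈ traceDual (D.inner i).stab, u ∉ (D.inner i).stab → w i ≤ hammingNorm u)
    {c : Fin (2 ^ m - 1) × Fin n₂ → F4} (hc : c ∈ traceDual D.code) (hc' : c ∉ D.code) :
    ∃ i, (D.k i + 1) * w i ≤ hammingNorm c := by
  set b : Fin s → (Fin (2 ^ m - 1) × Fin m → F4) :=
    fun i p => D.coords (fun t => c (p.1, t)) i p.2 with hb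
  have hcol (l) : column b l = D.coords (fun t => c (l, t)) := rfl
  -- Tested against the code words that consist of a word of C_s in block l and zeros elsewhere.
  have hlast (l) : (fun t => c (l, t)) ∈ traceDual D.lastStab := by
    rw [mem_traceDual]
    intro v hv
    have hmem : (fun p : Fin (2 ^ m - 1) × Fin n₂ => if p.1 = l then v p.2 else 0) ∈ D.code := by
      refine ⟨0, fun i => zero_mem _, fun l' => ?_⟩
      have h0 : D.rho (column (0 : Fin s → (Fin (2 ^ m - 1) × Fin m → F4)) l') = 0 :=
        D.rho.map_zero
      rw [h0, sub_zero]
      by_cases h : l' = l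
      · simpa [h] using hv
      · simp only [h, if_false]; exact zero_mem D.lastStab
    have h1 := mem_traceDual.1 hc _ hmem
    rw [symp_prod, Finset.sum_eq_single l] at h1
    · simpa using h1
    · intro l' _ hl'
      simp only [if_neg hl']
      exact map_zero _
    · simp
  have hdiff (l) : (fun t => c (l, t)) - D.rho (column b l) ∈ D.lastStab := by
    refine D.mem_lastStab (sub_mem (hlast l) (D.rho_mem_traceDual_lastStab _)) ?_
    rw [map_sub, coords_rho, hcol, sub_self]
  -- Tested against the encodings of matrices whose only nonzero row is the i-th.
  have hdual (i) : b i ∈ traceDual (D.outer i) := by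
    rw [mem_traceDual]
    intro v hv
    have hmem : D.encode (Pi.single i v) ∈ D.code := by
      refine ⟨Pi.single i v, fun j => ?_, fun l => ?_⟩
      · rcases eq_or_ne j i with rfl | hj
        · simpa using hv
        · simp [hj]
      · have : (fun t => D.encode (Pi.single i v) (l, t)) = D.rho (column (Pi.single i v) l) := rfl
        rw [this, sub_self]
        exact zero_mem _
    have h1 := mem_traceDual.1 hc _ hmem
    rw [symp_encode, Finset.sum_eq_single i] at h1
    · simpa using h1
    · intro j _ hj
      simp [hj]
    · simp
  obtain ⟨i, hi, hmax⟩ : ∃ i, b i ≠ 0 ∧ ∀ j, i < j → b j = 0 := by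
    have hne : (Finset.univ.filter fun i => b i ≠ 0).Nonempty := by
      by_contra hcon
      rw [Finset.not_nonempty_iff_eq_empty, Finset.filter_eq_empty_iff] at hcon
      push Not at hcon
      exact hc' ⟨b, fun i => by rw [hcon (Finset.mem_univ i)]; exact zero_mem _, hdiff⟩
    refine ⟨_, (Finset.mem_filter.1 (Finset.max'_mem _ hne)).2, fun j hj => ?_⟩
    by_contra hbj
    exact absurd (Finset.le_max' _ j (Finset.mem_filter.2 ⟨Finset.mem_univ _, hbj⟩)) (not_le.2 hj)
  refine ⟨i, ?_⟩
  -- The rows beyond i vanish, which places the block in C_i^⊥; its nonzero i-th coordinates keep it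
  -- out of C_i.
  have hblock (l) (hl : ∃ a, b i (l, a) ≠ 0) : w i ≤ hammingNorm (fun t => c (l, t)) := by
    refine hw i _ ?_ fun hmem => ?_
    · rw [← sub_add_cancel (fun t => c (l, t)) (D.rho (column b l))]
      refine add_mem ((D.inner i).selfOrthogonal (D.lastStab_le i (hdiff l))) (D.rho_mem ?_)
      intro j hj
      funext a
      exact congrFun (hmax j hj) (l, a)
    · obtain ⟨a, ha⟩ := hl
      exact ha (congrFun (D.coords_eq_zero_of_mem hmem) a)
  calc (D.k i + 1) * w i
      ≤ (Finset.univ.filter fun l => ∃ a, b i (l, a) ≠ 0).card * w i :=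
        Nat.mul_le_mul_right _ ((D.outer_isRS i).lt_card_blocks (hdual i) hi)
    _ ≤ ∑ l ∈ Finset.univ.filter (fun l => ∃ a, b i (l, a) ≠ 0),
          hammingNorm (fun t => c (l, t)) := by
        rw [← smul_eq_mul, ← nsmul_eq_smul]
        exact Finset.card_nsmul_le_sum _ _ _ fun l hl => hblock l (Finset.mem_filter.1 hl).2
    _ ≤ hammingNorm c := by
        rw [hammingNorm_prod]
        exact Finset.sum_le_sum_of_subset (Finset.filter_subset _ _)

end GCData

/-- A quantum code encoding at least one qubit has a minimum distance. -/
theorem QuantumCode.exists_hasMinDist {ι : Type*} [Fintype ι] (Q : QuantumCode ι) {k : ℕ}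
    (hk : 0 < k) (hQ : Q.Encodes k) : ∃ d, Q.HasMinDist d := by
  classical
  -- If C^⊥ = C then |C|² = 4^n, which contradicts |C| 2^k = 2^n with k > 0.
  have hne : ∃ u ∈ traceDual Q.stab, u ∉ Q.stab := by
    by_contra! hcon
    have h1 : traceDual Q.stab = Q.stab := le_antisymm hcon Q.selfOrthogonal
    have h2 := natCard_mul_natCard_traceDual Q.stab
    have h3 : (4 : ℕ) ^ Fintype.card ι = 2 ^ Fintype.card ι * 2 ^ Fintype.card ι := by
      rw [← mul_pow]; norm_num
    have h5 : 0 < Nat.card Q.stab := Nat.card_pos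
    have h6 : 1 < 2 ^ k := Nat.one_lt_two_pow hk.ne'
    rw [h1, h3, ← hQ] at h2
    have h7 : Nat.card Q.stab < Nat.card Q.stab * 2 ^ k := lt_mul_right h5 h6
    exact absurd h2 (Nat.mul_lt_mul'' h7 h7).ne
  obtain ⟨u, hu, hu'⟩ := hne
  exact ⟨_, isLeast_csInf ⟨_, u, hu, hu', rfl⟩⟩

/-! ### Symplectic isometries -/

section Isometry

variable {ι : Type*} [Fintype ι]

/-- Invertible maps preserving the trace inner product. -/
def IsSympIsometry (T : (ι → F4) ≃ₗ[ZMod 2] (ι → F4)) : Prop :=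
  ∀ u v, symp (T u) (T v) = symp u v

theorem IsSympIsometry.trans {S T : (ι → F4) ≃ₗ[ZMod 2] (ι → F4)} (hS : IsSympIsometry S)
    (hT : IsSympIsometry T) : IsSympIsometry (S.trans T) := fun u v => by
  rw [LinearEquiv.trans_apply, LinearEquiv.trans_apply, hT, hS]

theorem IsSympIsometry.symm {T : (ι → F4) ≃ₗ[ZMod 2] (ι → F4)} (hT : IsSympIsometry T) :
    IsSympIsometry T.symm := fun u v => by
  rw [← hT, T.apply_symm_apply, T.apply_symm_apply]

theorem zmod_two_add_self (r : ZMod 2) : r + r = 0 := by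
  revert r; decide

/-- The transvection `x ↦ x + ⟨x, u⟩ u`. -/
noncomputable def transvection (u : ι → F4) : (ι → F4) ≃ₗ[ZMod 2] (ι → F4) :=
  LinearEquiv.ofInvolutive (LinearMap.id + (symp u).smulRight u) fun x => by
    simp only [LinearMap.add_apply, LinearMap.id_apply, LinearMap.smulRight_apply, map_add,
      map_smul, symp_self, zero_smul, add_zero]
    rw [add_assoc, ← add_smul, zmod_two_add_self, zero_smul, add_zero]

theorem transvection_apply (u x : ι → F4) : transvection u x = x + symp x u • u := by
  rw [symp_comm]; rfl

theorem transvection_isometry (u : ι → F4) : IsSympIsometry (transvection u) := fun x y => by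
  simp only [transvection_apply, map_add, map_smul, LinearMap.add_apply, LinearMap.smul_apply,
    symp_self, smul_eq_mul, mul_zero, add_zero, symp_comm u y]
  rw [add_assoc, mul_comm, zmod_two_add_self, add_zero]

theorem pi_add_self {ι : Type*} (u : ι → F4) : u + u = 0 := by
  funext i
  exact CharTwo.add_self_eq_zero (u i)

/-- Since ⟨v, v + w⟩ = 1, the transvection along v + w sends v to v + (v + w) = w. -/
theorem exists_isometry_of_symp_eq_one {v w : ι → F4} (h : symp v w = 1) :
    ∃ T, IsSympIsometry T ∧ T v = w := by
  refine ⟨transvection (v + w), transvection_isometry _, ?_⟩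
  rw [transvection_apply, map_add, symp_self, h, zero_add, one_smul, ← add_assoc, pi_add_self,
    zero_add]

/-- The isometries act transitively on the nonzero words. -/
theorem exists_isometry {v w : ι → F4} (hv : v ≠ 0) (hw : w ≠ 0) :
    ∃ T, IsSympIsometry T ∧ T v = w := by
  -- Two transvections through an intermediate word z suffice, provided z pairs to 1 with both v and
  -- w.
  obtain ⟨z, hvz, hwz⟩ : ∃ z, symp v z = 1 ∧ symp w z = 1 := by
    obtain ⟨a, ha⟩ := exists_symp_ne_zero hv
    obtain ⟨b, hb⟩ := exists_symp_ne_zero hw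
    by_cases hwa : symp w a = 0
    · by_cases hvb : symp v b = 0
      · exact ⟨a + b, by rw [map_add, ha, hvb, add_zero], by rw [map_add, hb, hwa, zero_add]⟩
      · exact ⟨b, zmod_two_eq_one hvb, hb⟩
    · exact ⟨a, ha, zmod_two_eq_one hwa⟩
  obtain ⟨S, hS, hSv⟩ := exists_isometry_of_symp_eq_one hvz
  obtain ⟨T, hT, hTz⟩ := exists_isometry_of_symp_eq_one ((symp_comm z w).trans hwz)
  exact ⟨S.trans T, hS.trans hT, by rw [LinearEquiv.trans_apply, hSv, hTz]⟩

/-- An isometry avoiding a small set of pairs of nonzero words, by averaging. -/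
theorem exists_isometry_avoiding (P : Finset ((ι → F4) × (ι → F4)))
    (hP : ∀ p ∈ P, p.1 ≠ 0 ∧ p.2 ≠ 0) (hcard : P.card + 1 < 4 ^ Fintype.card ι) :
    ∃ T, IsSympIsometry T ∧ ∀ p ∈ P, T p.1 ≠ p.2 := by
  classical
  have : Finite ((ι → F4) ≃ₗ[ZMod 2] (ι → F4)) :=
    Finite.of_injective (fun T => (T : (ι → F4) → (ι → F4))) DFunLike.coe_injective
  let _ : Fintype ((ι → F4) ≃ₗ[ZMod 2] (ι → F4)) := Fintype.ofFinite _
  let _ : Fintype F4 := Fintype.ofFinite _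
  set G : Finset ((ι → F4) ≃ₗ[ZMod 2] (ι → F4)) := Finset.univ.filter IsSympIsometry with hG
  have hGpos : 0 < G.card := by
    refine Finset.card_pos.2 ⟨LinearEquiv.refl _ _, ?_⟩
    rw [hG, Finset.mem_filter]
    exact ⟨Finset.mem_univ _, fun u v => rfl⟩
  -- Composing with isometries shows that the images of v are equidistributed over the 4^n - 1
  -- nonzero words.
  have hone {v w : ι → F4} (hv : v ≠ 0) (hw : w ≠ 0) :
      (G.filter fun T => T v = w).card * (4 ^ Fintype.card ι - 1) = G.card := by
    have hN {w' : ι → F4} (hw' : w' ≠ 0) :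
        (G.filter fun T => T v = w').card = (G.filter fun T => T v = w).card := by
      obtain ⟨S, hS, hSw⟩ := exists_isometry hw' hw
      refine Finset.card_bij' (fun T _ => T.trans S) (fun T _ => T.trans S.symm) ?_ ?_ ?_ ?_
      · intro T hT
        simp only [hG, Finset.mem_filter, Finset.mem_univ, true_and] at hT ⊢
        exact ⟨hT.1.trans hS, by rw [LinearEquiv.trans_apply, hT.2, hSw]⟩
      · intro T hT
        simp only [hG, Finset.mem_filter, Finset.mem_univ, true_and] at hT ⊢
        exact ⟨hT.1.trans hS.symm, by
          rw [LinearEquiv.trans_apply, hT.2, ← hSw, S.symm_apply_apply]⟩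
      · intro T _
        ext1 x
        simp
      · intro T _
        ext1 x
        simp
    have hsum := Finset.card_eq_sum_card_fiberwise (f := fun T => T v) (s := G)
      (t := Finset.univ.erase 0) (fun T _ => by simpa using hv)
    rw [hsum, Finset.sum_congr rfl fun w' hw' => hN (Finset.ne_of_mem_erase hw'),
      Finset.sum_const, Finset.card_erase_of_mem (Finset.mem_univ _), Finset.card_univ,
      ← Nat.card_eq_fintype_card (α := ι → F4), natCard_pi_F4, smul_eq_mul, mul_comm]
  by_contra! hcon
  have hle : G.card ≤ ∑ p ∈ P, (G.filter fun T => T p.1 = p.2).card := by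
    refine (Finset.card_le_card fun T hT => ?_).trans Finset.card_biUnion_le
    obtain ⟨p, hp, hTp⟩ := hcon T (Finset.mem_filter.1 hT).2
    exact Finset.mem_biUnion.2 ⟨p, hp, Finset.mem_filter.2 ⟨hT, hTp⟩⟩
  have h1 : G.card * (4 ^ Fintype.card ι - 1) ≤ G.card * P.card := by
    refine (Nat.mul_le_mul_right _ hle).trans (le_of_eq ?_)
    rw [Finset.sum_mul, Finset.sum_congr rfl fun p hp => hone (hP p hp).1 (hP p hp).2,
      Finset.sum_const, smul_eq_mul, mul_comm]
  have h2 := Nat.le_of_mul_le_mul_left h1 hGpos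
  omega

theorem mem_traceDual_map {T : (ι → F4) ≃ₗ[ZMod 2] (ι → F4)} (hT : IsSympIsometry T)
    {C : AddSubgroup (ι → F4)} {u : ι → F4} :
    T u ∈ traceDual (C.map (T : (ι → F4) →+ (ι → F4))) ↔ u ∈ traceDual C := by
  simp only [mem_traceDual, AddSubgroup.mem_map, forall_exists_index, and_imp,
    forall_apply_eq_imp_iff₂]
  exact forall₂_congr fun v _ => by rw [← hT u v]; rfl

end Isometry

/-! ### A random chain of self-orthogonal codes -/

section Chain

variable {n : ℕ}

/-- The code of all words with entries in `{0, ω}` that vanish in the first `t` coordinates. -/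
noncomputable def stdStab (n t : ℕ) : AddSubgroup (Fin n → F4) where
  carrier := {u | ∀ i, binTrace (u i) omega = 0 ∧ ((i : ℕ) < t → u i = 0)}
  zero_mem' i := by simp [binTrace]
  add_mem' {u v} hu hv i := by
    refine ⟨?_, fun h => ?_⟩
    · rw [Pi.add_apply, binTrace_add_left, (hu i).1, (hv i).1, add_zero]
    · rw [Pi.add_apply, (hu i).2 h, (hv i).2 h, add_zero]
  neg_mem' {u} hu i := by
    rw [Pi.neg_apply, CharTwo.neg_eq]
    exact hu i

theorem stdStab_anti {t t' : ℕ} (h : t ≤ t') : stdStab n t' ≤ stdStab n t :=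
  fun _ hu i => ⟨(hu i).1, fun hi => (hu i).2 (hi.trans_le h)⟩

theorem binTrace_eq_zero {x y : F4} (hx : binTrace x omega = 0) (hy : binTrace y omega = 0) :
    binTrace x y = 0 := by
  rw [← binTrace_smul_add x, ← binTrace_smul_add y, binTrace_quat, hx, hy, mul_zero, zero_mul,
    add_zero]

theorem stdStab_selfOrthogonal (t : ℕ) : stdStab n t ≤ traceDual (stdStab n t) := by
  rw [le_traceDual_iff]
  intro u hu v hv
  rw [symp_apply]
  exact Finset.sum_eq_zero fun i _ => binTrace_eq_zero (hu i).1 (hv i).1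

theorem natCard_stdStab {t : ℕ} (ht : t ≤ n) : Nat.card (stdStab n t) * 2 ^ t = 2 ^ n := by
  have h1 (i : Fin n) : Nat.card {z : F4 // binTrace z omega = 0 ∧ ((i : ℕ) < t → z = 0)}
      = if (i : ℕ) < t then 1 else 2 := by
    split_ifs with h
    · rw [Nat.card_eq_one_iff_unique]
      exact ⟨⟨fun x y => Subtype.ext ((x.2.2 h).trans (y.2.2 h).symm)⟩,
        ⟨⟨0, by simp [binTrace], fun _ => rfl⟩⟩⟩
    · refine Eq.trans (Nat.card_congr (Equiv.ofBijective (fun r : ZMod 2 => ⟨r • omega, by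
        rw [binTrace_smul_left, binTrace_self, mul_zero], fun h' => absurd h' h⟩) ⟨?_, ?_⟩)).symm
        (Nat.card_zmod 2)
      · intro r r' hr
        have := congrArg (fun z => binTrace z (omega ^ 2)) (congrArg Subtype.val hr)
        simpa [binTrace_smul_left, binTrace_omega_omega_sq] using this
      · rintro ⟨z, hz, _⟩
        have h3 := binTrace_smul_add z
        rw [hz, zero_smul, add_zero] at h3
        exact ⟨binTrace z (omega ^ 2), Subtype.ext h3⟩
  have h2 : Nat.card (stdStab n t) = ∏ i : Fin n, if (i : ℕ) < t then 1 else 2 := by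
    rw [← Finset.prod_congr rfl fun i _ => h1 i, ← Nat.card_pi]
    exact Nat.card_congr (Equiv.subtypePiEquivPi (p := fun (i : Fin n) (z : F4) =>
      binTrace z omega = 0 ∧ ((i : ℕ) < t → z = 0)))
  obtain ⟨r, rfl⟩ := Nat.exists_eq_add_of_le ht
  rw [h2, Fin.prod_univ_eq_prod_range (fun i => if i < t then 1 else 2), Finset.prod_range_add,
    Finset.prod_congr rfl fun i hi => if_pos (Finset.mem_range.1 hi),
    Finset.prod_congr rfl fun i _ => if_neg (show ¬ t + i < t by omega)]
  simp only [Finset.prod_const, Finset.card_range, one_pow, one_mul]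
  rw [pow_add, mul_comm]

theorem natCard_traceDual_stdStab {t : ℕ} (ht : t ≤ n) :
    Nat.card (traceDual (stdStab n t)) = 2 ^ (n + t) := by
  have h1 := natCard_mul_natCard_traceDual (stdStab n t)
  have h2 := natCard_stdStab ht
  have h3 : (4 : ℕ) ^ n = 2 ^ n * 2 ^ n := by rw [← mul_pow]; norm_num
  have h4 : 0 < Nat.card (stdStab n t) := Nat.card_pos
  refine Nat.eq_of_mul_eq_mul_left h4 ?_
  rw [h1, Fintype.card_fin, pow_add, mul_left_comm, h2, h3]

theorem single_mem_traceDual_stdStab {t : ℕ} {i : Fin n} (hi : (i : ℕ) < t) (z : F4) :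
    Pi.single i z ∈ traceDual (stdStab n t) := by
  rw [mem_traceDual]
  intro v hv
  rw [symp_comm, symp_single, (hv i).2 hi]
  simp [binTrace]

open Classical in
/-- The number of words of weight less than `w`. -/
noncomputable def ballCard (n w : ℕ) : ℕ := Nat.card {u : Fin n → F4 // hammingNorm u < w}

open Classical in
/-- A Gilbert–Varshamov bound for a chain of codes. -/
theorem exists_isometry_hammingNorm {s : ℕ} (t w : Fin s → ℕ) (ht : ∀ j, t j ≤ n)
    (hcount : ∑ j, 2 ^ (n + t j) * ballCard n (w j) + 1 < 4 ^ n) :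
    ∃ T : (Fin n → F4) ≃ₗ[ZMod 2] (Fin n → F4), IsSympIsometry T ∧
      ∀ j, ∀ u ∈ traceDual (stdStab n (t j)), u ≠ 0 → w j ≤ hammingNorm (T u) := by
  let _ : Fintype F4 := Fintype.ofFinite _
  -- The forbidden pairs: a nonzero word of the j-th dual code must not be sent to a nonzero word of
  -- weight below w j.
  set P : Finset ((Fin n → F4) × (Fin n → F4)) := Finset.univ.biUnion fun j =>
    (Finset.univ.filter fun u => u ∈ traceDual (stdStab n (t j)) ∧ u ≠ 0) ×ˢ
      (Finset.univ.filter fun u => hammingNorm u < w j ∧ u ≠ 0) with hP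
  have hcard : P.card ≤ ∑ j, 2 ^ (n + t j) * ballCard n (w j) := by
    refine Finset.card_biUnion_le.trans (Finset.sum_le_sum fun j _ => ?_)
    rw [Finset.card_product]
    refine Nat.mul_le_mul ?_ ?_
    · rw [← natCard_traceDual_stdStab (ht j)]
      change _ ≤ Nat.card {u // u ∈ traceDual (stdStab n (t j))}
      rw [Nat.card_eq_fintype_card, Fintype.card_subtype]
      exact Finset.card_le_card fun u hu => by
        rw [Finset.mem_filter] at hu ⊢
        exact ⟨hu.1, hu.2.1⟩
    · rw [ballCard, Nat.card_eq_fintype_card, Fintype.card_subtype]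
      exact Finset.card_le_card fun u hu => by
        rw [Finset.mem_filter] at hu ⊢
        exact ⟨hu.1, hu.2.1⟩
  obtain ⟨T, hT, hav⟩ := exists_isometry_avoiding P (fun p hp => by
    simp only [hP, Finset.mem_biUnion, Finset.mem_product, Finset.mem_filter] at hp
    obtain ⟨j, _, h1, h2⟩ := hp
    exact ⟨h1.2.2, h2.2.2⟩) (by rw [Fintype.card_fin]; omega)
  refine ⟨T, hT, fun j u hu hu0 => ?_⟩
  by_contra! hlt
  refine hav (u, T u) ?_ rfl
  simp only [hP, Finset.mem_biUnion, Finset.mem_product, Finset.mem_filter, Finset.mem_univ,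
    true_and]
  exact ⟨j, ⟨hu, hu0⟩, hlt, fun h => hu0 (T.map_eq_zero_iff.1 h)⟩

/-- Coordinate `(j, a)` among the first `s m` of `n` coordinates. -/
def chainIndex {s m n : ℕ} (hn : s * m ≤ n) (j : Fin s) (a : Fin m) : Fin n :=
  Fin.castLE hn (finProdFinEquiv (j, a))

theorem chainIndex_lt {s m n : ℕ} (hn : s * m ≤ n) (j : Fin s) (a : Fin m) :
    (chainIndex hn j a : ℕ) < ((j : ℕ) + 1) * m := by
  have h1 : (chainIndex hn j a : ℕ) = a + m * j := rfl
  have := a.2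
  rw [h1]
  nlinarith

theorem chainIndex_inj {s m n : ℕ} (hn : s * m ≤ n) {i j : Fin s} {a b : Fin m} :
    chainIndex hn i a = chainIndex hn j b ↔ i = j ∧ a = b := by
  rw [chainIndex, chainIndex, (Fin.castLE_injective hn).eq_iff,
    finProdFinEquiv.injective.eq_iff, Prod.mk.injEq]

theorem chain_le {s m n : ℕ} (hn : s * m ≤ n) (j : Fin s) : ((j : ℕ) + 1) * m ≤ n :=
  (Nat.mul_le_mul_right m j.2).trans hn

/-- Generalized concatenation with the image of the standard chain under an isometry. -/
noncomputable def chainData {s m n : ℕ} (hs : 2 ≤ s) (hn : s * m ≤ n)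
    (T : (Fin n → F4) ≃ₗ[ZMod 2] (Fin n → F4)) (hT : IsSympIsometry T) (k : Fin s → ℕ)
    (B : Fin s → AddSubgroup (Fin (2 ^ m - 1) × Fin m → F4))
    (hB : ∀ i, IsQuantumReedSolomon m (k i) (B i)) : GCData s m n where
  two_le := hs
  k := k
  outer := B
  outer_isRS := hB
  inner j :=
    { stab := (stdStab n (((j : ℕ) + 1) * m)).map (T : (Fin n → F4) →+ (Fin n → F4))
      selfOrthogonal := by
        rintro _ ⟨u, hu, rfl⟩
        exact (mem_traceDual_map hT).2 (stdStab_selfOrthogonal _ hu) }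
  inner_encodes j := by
    rw [QuantumCode.Encodes, Fintype.card_fin, ← natCard_stdStab (chain_le hn j)]
    congr 1
    exact Nat.card_congr (((stdStab n _).equivMapOfInjective _ T.injective).toEquiv.symm)
  inner_nested i j hij :=
    AddSubgroup.map_mono (stdStab_anti (Nat.mul_le_mul_right m (Nat.succ_le_succ hij)))
  g j a := T (Pi.single (chainIndex hn j a) omega)
  h j a := T (Pi.single (chainIndex hn j a) (omega ^ 2))
  g_mem j a := (mem_traceDual_map hT).2 (single_mem_traceDual_stdStab (chainIndex_lt hn j a) _)
  h_mem j a := (mem_traceDual_map hT).2 (single_mem_traceDual_stdStab (chainIndex_lt hn j a) _)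
  inner_g_h i a j b := by
    rw [← algebraMap_symp, hT, symp_single]
    by_cases h : i = j ∧ a = b
    · rw [if_pos h, h.1, h.2, Pi.single_eq_same, binTrace_omega_omega_sq, map_one]
    · rw [if_neg h, Pi.single_eq_of_ne (fun h' => h ((chainIndex_inj hn).1 h'.symm))]
      simp [binTrace]
  inner_g_g i a j b := by
    rw [← algebraMap_symp, hT, symp_single]
    by_cases h : chainIndex hn j b = chainIndex hn i a
    · rw [h, Pi.single_eq_same, binTrace_self, map_zero]
    · rw [Pi.single_eq_of_ne h]
      simp [binTrace]
  inner_h_h i a j b := by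
    rw [← algebraMap_symp, hT, symp_single]
    by_cases h : chainIndex hn j b = chainIndex hn i a
    · rw [h, Pi.single_eq_same, binTrace_self, map_zero]
    · rw [Pi.single_eq_of_ne h]
      simp [binTrace]

/-- If a Gilbert–Varshamov count holds, there is a generalized concatenated code with minimum
distance at least `minᵢ (kᵢ + 1) wᵢ`. -/
theorem exists_generalizedConcatenated {s m n : ℕ} (hs : 2 ≤ s) (hn : s * m ≤ n) (w k : Fin s → ℕ)
    (hk : ∀ i, 1 ≤ k i ∧ k i ≤ 2 ^ (m - 1) - 1)
    (hcount : ∑ j : Fin s, 2 ^ (n + ((j : ℕ) + 1) * m) * ballCard n (w j) + 1 < 4 ^ n) :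
    ∃ (Q : QuantumCode (Fin (2 ^ m - 1) × Fin n)) (d : ℕ), IsGeneralizedConcatenated s m n Q ∧
      Q.Encodes (∑ i, m * ((2 ^ m - 1) - 2 * k i)) ∧ Q.HasMinDist d ∧
      ∃ i, (k i + 1) * w i ≤ d := by
  obtain ⟨T, hT, hw⟩ := exists_isometry_hammingNorm (fun j : Fin s => ((j : ℕ) + 1) * m) w
    (chain_le hn) hcount
  choose B hB using fun i => exists_isQuantumReedSolomon (hk i).1 (hk i).2
  set D := chainData hs hn T hT k B hB with hD
  have henc : D.quantumCode.Encodes (∑ i, m * ((2 ^ m - 1) - 2 * k i)) := D.quantumCode_encodes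
  have hpos : 0 < ∑ i, m * ((2 ^ m - 1) - 2 * k i) := by
    have hterm (i : Fin s) : 0 < m * ((2 ^ m - 1) - 2 * k i) := by
      obtain ⟨h1, h2⟩ := two_mul_lt_of_le (hk i).1 (hk i).2
      exact Nat.mul_pos (Nat.pos_of_ne_zero h1) (by omega)
    exact Finset.sum_pos (fun i _ => hterm i) ⟨⟨0, by omega⟩, Finset.mem_univ _⟩
  obtain ⟨d, hd⟩ := D.quantumCode.exists_hasMinDist hpos henc
  refine ⟨D.quantumCode, d, ⟨D, rfl⟩, henc, hd, ?_⟩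
  obtain ⟨c, hc, hc', hcd⟩ := hd.1
  rw [← hcd]
  -- The weight bound for the chain holds for all nonzero dual words; lying outside the stabilizer
  -- serves only to make the preimage nonzero.
  refine D.exists_le_hammingNorm (w := w) (fun i u hu hu' => ?_) hc hc'
  have h1 : T (T.symm u) = u := T.apply_symm_apply u
  rw [← h1] at hu ⊢
  refine hw i _ ((mem_traceDual_map hT).1 hu) fun h0 => hu' ?_
  rw [← h1, h0, map_zero]
  exact zero_mem _

end Chain

/-! ### The entropy function -/

section Entropy

theorem H4_strictMonoOn : StrictMonoOn H4 (Set.Icc 0 (3 / 4)) := by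
  have h := Real.qaryEntropy_strictMonoOn (q := 4) (by norm_num)
  have h1 : (1 : ℝ) - 1 / (4 : ℕ) = 3 / 4 := by norm_num
  rw [h1] at h
  exact fun x hx y hy hxy => div_lt_div_of_pos_right (h hx hy hxy) (Real.log_pos (by norm_num))

theorem H4_zero : H4 0 = 0 := by simp [H4]

theorem H4_three_quarters : H4 (3 / 4) = 1 := by
  have h4 : Real.log 4 ≠ 0 := (Real.log_pos (by norm_num)).ne'
  have h : Real.qaryEntropy 4 (3 / 4) = Real.log 4 := by
    rw [Real.qaryEntropy, Real.binEntropy]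
    have h1 : (1 : ℝ) - 3 / 4 = 4⁻¹ := by norm_num
    have h2 : ((3 : ℝ) / 4)⁻¹ = 4 / 3 := by norm_num
    have h3 : (((4 : ℕ) : ℤ) - 1 : ℤ) = 3 := by norm_num
    rw [h1, h2, h3, inv_inv, Real.log_div (by norm_num) (by norm_num)]
    push_cast
    ring_nf
  rw [H4, h, div_self h4]

theorem H4_bijOn : Set.BijOn H4 (Set.Icc 0 (3 / 4)) (Set.Icc 0 1) := by
  have h0 : (0 : ℝ) ≤ 3 / 4 := by norm_num
  refine ⟨fun x hx => ⟨?_, ?_⟩, H4_strictMonoOn.injOn, ?_⟩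
  · rw [← H4_zero]
    exact H4_strictMonoOn.monotoneOn (Set.left_mem_Icc.2 h0) hx hx.1
  · rw [← H4_three_quarters]
    exact H4_strictMonoOn.monotoneOn hx (Set.right_mem_Icc.2 h0) hx.2
  · have hc : ContinuousOn H4 (Set.Icc 0 (3 / 4)) :=
      (Real.qaryEntropy_continuous.div_const _).continuousOn
    have := intermediate_value_Icc h0 hc
    rwa [H4_zero, H4_three_quarters] at this

theorem H4inv_mem {y : ℝ} (hy : y ∈ Set.Icc (0 : ℝ) 1) : H4inv y ∈ Set.Icc (0 : ℝ) (3 / 4) :=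
  Function.invFunOn_mem (H4_bijOn.surjOn hy)

theorem H4_H4inv {y : ℝ} (hy : y ∈ Set.Icc (0 : ℝ) 1) : H4 (H4inv y) = y :=
  Function.invFunOn_eq (H4_bijOn.surjOn hy)

theorem H4inv_H4 {x : ℝ} (hx : x ∈ Set.Icc (0 : ℝ) (3 / 4)) : H4inv (H4 x) = x :=
  H4_strictMonoOn.injOn (H4inv_mem (H4_bijOn.mapsTo hx)) hx (H4_H4inv (H4_bijOn.mapsTo hx))

theorem H4inv_monotoneOn : MonotoneOn H4inv (Set.Icc 0 1) := by
  intro y hy z hz hyz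
  by_contra! h
  have := H4_strictMonoOn (H4inv_mem hz) (H4inv_mem hy) h
  rw [H4_H4inv hy, H4_H4inv hz] at this
  linarith

theorem qaryEntropy_four_eq (x : ℝ) : Real.qaryEntropy 4 x = H4 x * (2 * Real.log 2) := by
  have h4 : Real.log 4 = 2 * Real.log 2 := by
    rw [show (4 : ℝ) = 2 ^ 2 by norm_num, Real.log_pow]; norm_num
  have h : Real.log 4 ≠ 0 := (Real.log_pos (by norm_num)).ne'
  rw [H4, ← h4, div_mul_cancel₀ _ h]

end Entropy

/-! ### The volume of Hamming balls -/

/-- Hamming balls of relative radius `τ ≤ 3/4` have at most `4 ^ (n H₄(τ))` elements. -/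
theorem ballCard_le {τ : ℝ} (h0 : 0 < τ) (h1 : τ ≤ 3 / 4) {n w : ℕ}
    (hw : ∀ r : ℕ, r < w → (r : ℝ) ≤ τ * n) :
    (ballCard n w : ℝ) ≤ Real.exp (n * Real.qaryEntropy 4 τ) := by
  classical
  let _ : Fintype F4 := Fintype.ofFinite _
  set L := Real.log (1 - τ) with hL
  set c := Real.log (τ / 3) - L with hc
  have hpos : 0 < 1 - τ := by linarith
  have hc0 : c ≤ 0 := sub_nonpos.2 (Real.log_le_log (by linarith) (by linarith))
  have hent : Real.qaryEntropy 4 τ = -(L + τ * c) := by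
    rw [Real.qaryEntropy, Real.binEntropy_eq_negMulLog_add_negMulLog_one_sub, Real.negMulLog,
      Real.negMulLog, hc, Real.log_div h0.ne' (by norm_num), hL]
    have h5 : (((4 : ℕ) : ℤ) - 1 : ℤ) = (3 : ℤ) := by norm_num
    rw [h5]
    push_cast
    ring
  -- The product distribution with mass 1 - τ at 0 and τ/3 at each nonzero symbol. Since c ≤ 0 for τ
  -- ≤ 3/4, each word of the ball has probability at least exp(-n h(τ)), where h is
  -- `Real.qaryEntropy 4`.
  set f : F4 → ℝ := fun z => Real.exp (L + if z ≠ 0 then c else 0) with hf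
  have hsum : ∑ z, f z = 1 := by
    have hcard : Fintype.card F4 = 4 := by rw [← Nat.card_eq_fintype_card, natCard_F4]
    rw [← Finset.add_sum_erase _ _ (Finset.mem_univ 0),
      Finset.sum_congr rfl (g := fun _ => τ / 3), Finset.sum_const,
      Finset.card_erase_of_mem (Finset.mem_univ _), Finset.card_univ, hcard]
    · simp only [hf, ne_eq, not_true_eq_false, if_false, add_zero, hL, Real.exp_log hpos]
      norm_num
      ring
    · intro z hz
      simp only [hf, if_pos (Finset.ne_of_mem_erase hz), hc, add_sub_cancel]
      exact Real.exp_log (by linarith)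
  have hprod (u : Fin n → F4) :
      ∏ i, f (u i) = Real.exp (n * L + hammingNorm u * c) := by
    rw [← Real.exp_sum, Finset.sum_add_distrib, ← Finset.sum_filter]
    simp [hammingNorm]
  have htot : ∑ u : Fin n → F4, ∏ i, f (u i) = 1 := by
    rw [← Fintype.sum_pow, hsum, one_pow]
  have hball : ballCard n w = (Finset.univ.filter fun u : Fin n → F4 => hammingNorm u < w).card := by
    rw [ballCard, Nat.card_eq_fintype_card, Fintype.card_subtype]
  have hle : (ballCard n w : ℝ) * Real.exp (-(n * Real.qaryEntropy 4 τ)) ≤ 1 := by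
    rw [← htot, hball, ← nsmul_eq_mul]
    refine (Finset.card_nsmul_le_sum _ _ _ fun u hu => ?_).trans
      (Finset.sum_le_sum_of_subset_of_nonneg (Finset.filter_subset _ _)
        fun u _ _ => Finset.prod_nonneg fun i _ => (Real.exp_pos _).le)
    rw [hprod, Real.exp_le_exp, hent]
    have := hw _ (Finset.mem_filter.1 hu).2
    nlinarith
  rw [Real.exp_neg, ← div_eq_mul_inv, div_le_one (Real.exp_pos _)] at hle
  exact hle

/-! ### Riemann sums -/

/-- For monotone f the integral lies between the left and right sums, whose difference telescopes.
-/
theorem abs_riemann_sub_integral_le {f : ℝ → ℝ} {a : ℝ} (ha : 0 < a)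
    (hf : MonotoneOn f (Set.Icc 0 a)) {s : ℕ} (hs : 0 < s) :
    |a / s * ∑ j ∈ Finset.range s, f ((j + 1) * a / s) - ∫ x in (0 : ℝ)..a, f x|
      ≤ a / s * (f a - f 0) := by
  have hs' : (0 : ℝ) < s := Nat.cast_pos.2 hs
  have hc : 0 < a / s := div_pos ha hs'
  set g : ℝ → ℝ := fun t => f (a / s * t) with hg
  have hgm : MonotoneOn g (Set.Icc (0 : ℝ) (0 + s)) := by
    have hmaps (t : ℝ) (ht : t ∈ Set.Icc (0 : ℝ) (0 + s)) : a / s * t ∈ Set.Icc 0 a := by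
      refine ⟨mul_nonneg hc.le ht.1, ?_⟩
      rw [div_mul_eq_mul_div, div_le_iff₀ hs']
      exact mul_le_mul_of_nonneg_left (by linarith [ht.2]) ha.le
    exact fun x hx y hy hxy => hf (hmaps x hx) (hmaps y hy) (mul_le_mul_of_nonneg_left hxy hc.le)
  have h1 := hgm.integral_le_sum
  have h2 := hgm.sum_le_integral
  have h3 : a / s * ∫ t in (0 : ℝ)..(0 + s), g t = ∫ x in (0 : ℝ)..a, f x := by
    rw [hg, intervalIntegral.mul_integral_comp_mul_left, zero_add, mul_zero,
      div_mul_cancel₀ _ hs'.ne']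
  have h4 : ∑ j ∈ Finset.range s, f ((j + 1) * a / s)
      = ∑ i ∈ Finset.range s, g (0 + (i + 1 : ℕ)) := by
    refine Finset.sum_congr rfl fun j _ => ?_
    rw [hg]
    congr 1
    push_cast; ring
  have h5 : ∑ i ∈ Finset.range s, g (0 + (i + 1 : ℕ)) - ∑ i ∈ Finset.range s, g (0 + (i : ℕ))
      = f a - f 0 := by
    rw [← Finset.sum_sub_distrib, Finset.sum_range_sub (fun i : ℕ => g (0 + (i : ℝ)))]
    simp only [hg, zero_add, Nat.cast_zero, mul_zero, div_mul_cancel₀ _ hs'.ne']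
  rw [h4, ← h3, ← mul_sub, abs_mul, abs_of_pos hc]
  refine mul_le_mul_of_nonneg_left ?_ hc.le
  rw [abs_of_nonneg (by linarith)]
  linarith

/-! ### The quantum Blokh–Zyablov bound -/

/-- The relative distance on the Gilbert–Varshamov bound for rate `x`. -/
noncomputable def gvDist (x : ℝ) : ℝ := H4inv ((1 - x) / 2)

theorem H4_lt_half {δ : ℝ} (hδ0 : 0 < δ) (hδ1 : δ < H4inv (1 / 2)) :
    δ ∈ Set.Icc (0 : ℝ) (3 / 4) ∧ 0 < H4 δ ∧ H4 δ < 1 / 2 := by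
  have hm : (1 / 2 : ℝ) ∈ Set.Icc (0 : ℝ) 1 := by constructor <;> norm_num
  have h1 := H4inv_mem hm
  have hδ : δ ∈ Set.Icc (0 : ℝ) (3 / 4) := ⟨hδ0.le, hδ1.le.trans h1.2⟩
  refine ⟨hδ, ?_, ?_⟩
  · rw [← H4_zero]
    exact H4_strictMonoOn (Set.left_mem_Icc.2 (by norm_num)) hδ hδ0
  · rw [← H4_H4inv hm]
    exact H4_strictMonoOn hδ h1 hδ1

theorem gvDist_arg_mem {δ x : ℝ} (h0 : 0 < H4 δ) (hx : x ∈ Set.Icc 0 (1 - 2 * H4 δ)) :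
    (1 - x) / 2 ∈ Set.Icc (0 : ℝ) 1 :=
  ⟨by linarith [hx.2], by linarith [hx.1]⟩

theorem gvDist_anti {δ x y : ℝ} (h0 : 0 < H4 δ) (hx : x ∈ Set.Icc 0 (1 - 2 * H4 δ))
    (hy : y ∈ Set.Icc 0 (1 - 2 * H4 δ)) (hxy : x ≤ y) : gvDist y ≤ gvDist x :=
  H4inv_monotoneOn (gvDist_arg_mem h0 hy) (gvDist_arg_mem h0 hx) (by linarith)

theorem gvDist_end {δ : ℝ} (hδ : δ ∈ Set.Icc (0 : ℝ) (3 / 4)) : gvDist (1 - 2 * H4 δ) = δ := by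
  rw [gvDist, sub_sub_cancel, mul_div_cancel_left₀ _ two_ne_zero, H4inv_H4 hδ]

/-- `gvDist` decreases to the value δ at the right end. This keeps the ratios δ / τ_j at most 1 and
bounds the integrand by 1/δ. -/
theorem le_gvDist {δ x : ℝ} (hδ : δ ∈ Set.Icc (0 : ℝ) (3 / 4)) (h0 : 0 < H4 δ)
    (hx : x ∈ Set.Icc 0 (1 - 2 * H4 δ)) : δ ≤ gvDist x := by
  conv_lhs => rw [← gvDist_end hδ]
  exact gvDist_anti h0 hx (Set.right_mem_Icc.2 (hx.1.trans hx.2)) hx.2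

theorem H4_gvDist {δ x : ℝ} (h0 : 0 < H4 δ) (hx : x ∈ Set.Icc 0 (1 - 2 * H4 δ)) :
    H4 (gvDist x) = (1 - x) / 2 := H4_H4inv (gvDist_arg_mem h0 hx)

theorem node_mem {ρ : ℝ} (hρ : 0 < ρ) {s : ℕ} (j : Fin s) :
    ((j : ℕ) + 1 : ℝ) * ρ / s ∈ Set.Icc 0 ρ := by
  have hs : (0 : ℝ) < s := Nat.cast_pos.2 (by have := j.2; omega)
  have hj : ((j : ℕ) + 1 : ℝ) ≤ s := by exact_mod_cast j.2
  refine ⟨by positivity, ?_⟩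
  rw [div_le_iff₀ hs, mul_comm]
  exact mul_le_mul_of_nonneg_left hj hρ.le

/-- The integrand is increasing and equals 1/δ at the right end, so the factor δ in front cancels
and the error is at most ρ/s. -/
theorem abs_riemann_sub_bzRate_le {δ : ℝ} (hδ0 : 0 < δ) (hδ : δ ∈ Set.Icc (0 : ℝ) (3 / 4))
    (h0 : 0 < H4 δ) (h1 : H4 δ < 1 / 2) {s : ℕ} (hs : 0 < s) :
    |(1 - 2 * H4 δ) / s * ∑ j : Fin s, (1 - δ / gvDist (((j : ℕ) + 1) * (1 - 2 * H4 δ) / s))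
      - bzRate δ| ≤ 1 / s := by
  set ρ := 1 - 2 * H4 δ with hρ
  have hρ0 : 0 < ρ := by linarith
  have hs' : (0 : ℝ) < s := Nat.cast_pos.2 hs
  have hmono : MonotoneOn (fun x => 1 / H4inv ((1 - x) / 2)) (Set.Icc 0 ρ) := by
    intro x hx y hy hxy
    exact one_div_le_one_div_of_le (hδ0.trans_le (le_gvDist hδ h0 hy)) (gvDist_anti h0 hx hy hxy)
  have hR := abs_riemann_sub_integral_le hρ0 hmono hs
  rw [← Fin.sum_univ_eq_sum_range (fun j : ℕ => 1 / H4inv ((1 - ((j : ℝ) + 1) * ρ / s) / 2))] at hR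
  have hend : 1 / H4inv ((1 - ρ) / 2) = 1 / δ := congrArg _ (gvDist_end hδ)
  have hstart : 0 ≤ 1 / H4inv ((1 - 0) / 2) :=
    one_div_nonneg.2 (hδ0.le.trans (le_gvDist hδ h0 (Set.left_mem_Icc.2 hρ0.le)))
  have heq : ρ / s * ∑ j : Fin s, (1 - δ / gvDist (((j : ℕ) + 1) * ρ / s)) - bzRate δ
      = -δ * (ρ / s * ∑ j : Fin s, 1 / H4inv ((1 - ((j : ℕ) + 1) * ρ / s) / 2)
        - ∫ x in (0 : ℝ)..ρ, 1 / H4inv ((1 - x) / 2)) := by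
    rw [Finset.sum_sub_distrib, bzRate]
    simp only [Finset.sum_const, Finset.card_univ, Fintype.card_fin, nsmul_eq_mul, mul_one,
      div_eq_mul_one_div δ, ← Finset.mul_sum, gvDist]
    field_simp
    ring
  rw [heq, abs_mul, abs_neg, abs_of_pos hδ0]
  calc _ ≤ δ * (ρ / s * (1 / H4inv ((1 - ρ) / 2) - 1 / H4inv ((1 - 0) / 2))) :=
        mul_le_mul_of_nonneg_left hR hδ0.le
    _ ≤ δ * (ρ / s * (1 / δ)) := by
        have : 0 ≤ ρ / s := by positivity
        rw [hend]
        gcongr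
        linarith
    _ = ρ / s := by field_simp
    _ ≤ 1 / s := by
        gcongr
        linarith

/-- The Gilbert–Varshamov count for inner codes slightly below the bound. -/
theorem sum_ballCard_lt {δ : ℝ} (hδ0 : 0 < δ) (hδ : δ ∈ Set.Icc (0 : ℝ) (3 / 4))
    (h0 : 0 < H4 δ) (h1 : H4 δ < 1 / 2) {η : ℝ} (hη : 0 < η) {s m n : ℕ} (hn : 0 < n)
    (hsm : (s : ℝ) * m ≤ (1 - 2 * H4 δ - η) * n)
    (hbig : 4 * (s : ℝ) ^ 2 ≤ η * Real.log 2 * n) :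
    ∑ j : Fin s, 2 ^ (n + ((j : ℕ) + 1) * m) * ballCard n
      (⌊gvDist (((j : ℕ) + 1) * (1 - 2 * H4 δ) / s) * n⌋₊ + 1) + 1 < 4 ^ n := by
  set ρ := 1 - 2 * H4 δ with hρ
  have hρ0 : 0 < ρ := by linarith
  have hlog : 0 < Real.log 2 := Real.log_pos (by norm_num)
  have hn' : (0 : ℝ) < n := Nat.cast_pos.2 hn
  have h4n : (4 : ℝ) ^ n = Real.exp (2 * n * Real.log 2) := by
    rw [show (4 : ℝ) = 2 ^ 2 by norm_num, ← pow_mul, ← Real.exp_log (pow_pos two_pos (2 * n)),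
      Real.log_pow]
    push_cast; rfl
  -- Write J = j + 1. To base 2 the exponent is n + Jm + n(1 - Jρ/s) ≤ 2n - Jηn/s. By `hbig` the
  -- slack is at least 4s in natural units, and exp(-4s) ≤ 1/(4s).
  have hterm (j : Fin s) : (2 : ℝ) ^ (n + ((j : ℕ) + 1) * m) * ballCard n
      (⌊gvDist (((j : ℕ) + 1) * ρ / s) * n⌋₊ + 1) ≤ 4 ^ n * (1 / (4 * s)) := by
    have hs : (0 : ℝ) < s := Nat.cast_pos.2 (by have := j.2; omega)
    have hx := node_mem hρ0 j
    set τ := gvDist (((j : ℕ) + 1) * ρ / s) with hτ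
    have hτ0 : 0 < τ := hδ0.trans_le (le_gvDist hδ h0 hx)
    have hball := ballCard_le hτ0 (H4inv_mem (gvDist_arg_mem h0 hx)).2 (n := n)
      (w := ⌊τ * n⌋₊ + 1) fun r hr =>
        (Nat.le_floor_iff (by positivity)).1 (Nat.lt_succ_iff.1 hr)
    rw [qaryEntropy_four_eq, H4_gvDist h0 hx] at hball
    have h2 : (2 : ℝ) ^ (n + ((j : ℕ) + 1) * m)
        = Real.exp ((n + ((j : ℕ) + 1) * m) * Real.log 2) := by
      rw [← Real.exp_log (pow_pos two_pos (n + ((j : ℕ) + 1) * m)), Real.log_pow]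
      push_cast; rfl
    have h3 : (1 : ℝ) / (4 * s) ≥ Real.exp (-(4 * s)) := by
      rw [Real.exp_neg, ← one_div]
      exact one_div_le_one_div_of_le (by positivity)
        (by linarith [Real.add_one_le_exp (4 * (s : ℝ))])
    refine (mul_le_mul_of_nonneg_left hball (by positivity)).trans ?_
    refine le_trans ?_ (mul_le_mul_of_nonneg_left h3 (by positivity))
    rw [h2, h4n, ← Real.exp_add, ← Real.exp_add, Real.exp_le_exp]
    have hj1 : (1 : ℝ) ≤ (j : ℕ) + 1 := by linarith [(Nat.cast_nonneg (j : ℕ) : (0 : ℝ) ≤ _)]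
    have h5 : (((j : ℕ) + 1) * m : ℝ) ≤ ((j : ℕ) + 1) * ((ρ - η) * n / s) := by
      refine mul_le_mul_of_nonneg_left ?_ (by linarith)
      rw [le_div_iff₀ hs, mul_comm]
      exact hsm
    have h6 : (4 * s : ℝ) ≤ η * n / s * Real.log 2 := by
      rw [div_mul_eq_mul_div, le_div_iff₀ hs]
      linarith
    have h7 : η * n / s * Real.log 2 ≤ ((j : ℕ) + 1) * (η * n / s) * Real.log 2 := by
      have : 0 ≤ η * n / s := by positivity
      exact mul_le_mul_of_nonneg_right (le_mul_of_one_le_left this hj1) hlog.le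
    have h8 := mul_le_mul_of_nonneg_right h5 hlog.le
    have h9 : ((j : ℕ) + 1) * ((ρ - η) * n / s) * Real.log 2
        = n * (((j : ℕ) + 1) * ρ / s) * Real.log 2
          - ((j : ℕ) + 1) * (η * n / s) * Real.log 2 := by
      field_simp
    linear_combination h8 + h9 + h7 + h6
  have hsum : (∑ j : Fin s, (2 : ℝ) ^ (n + ((j : ℕ) + 1) * m) * ballCard n
      (⌊gvDist (((j : ℕ) + 1) * ρ / s) * n⌋₊ + 1)) ≤ 4 ^ n / 4 := by
    refine (Finset.sum_le_sum fun j _ => hterm j).trans ?_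
    rw [Finset.sum_const, Finset.card_univ, Fintype.card_fin, nsmul_eq_mul]
    rcases eq_or_ne (s : ℝ) 0 with hs | hs
    · rw [hs, zero_mul]; positivity
    · exact le_of_eq (by field_simp)
  have h4 : (4 : ℝ) ≤ 4 ^ n := le_self_pow₀ (by norm_num) hn.ne'
  have hfin : (∑ j : Fin s, (2 : ℝ) ^ (n + ((j : ℕ) + 1) * m) * ballCard n
      (⌊gvDist (((j : ℕ) + 1) * ρ / s) * n⌋₊ + 1)) + 1 < 4 ^ n := by linarith
  exact_mod_cast hfin

/-- Perturbing inner lengths and outer dimensions changes the rate only slightly. -/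
theorem abs_rate_sub_le {s : ℕ} (hs : 0 < s) {r ρ e e' : ℝ} {x q : Fin s → ℝ}
    (hr : r ≤ ρ) (hr' : ρ - e ≤ r) (hρ0 : 0 ≤ ρ) (hρ1 : ρ ≤ 1) (hq0 : ∀ i, 0 ≤ q i)
    (hq1 : ∀ i, q i ≤ 1) (hqx : ∀ i, q i ≤ x i) (hxq : ∀ i, x i ≤ q i + e') :
    |r / s * ∑ i, (1 - q i) - ρ / s * ∑ i, (1 - x i)| ≤ e + e' := by
  have hs' : (0 : ℝ) < s := Nat.cast_pos.2 hs
  set A := (∑ i, (1 - q i)) / s with hA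
  set A' := (∑ i, (1 - x i)) / s with hA'
  have hA0 : 0 ≤ A := div_nonneg (Finset.sum_nonneg fun i _ => sub_nonneg.2 (hq1 i)) hs'.le
  have hA1 : A ≤ 1 := by
    rw [hA, div_le_one hs']
    refine (Finset.sum_le_sum fun i _ => sub_le_self 1 (hq0 i)).trans ?_
    simp
  have hAA : A' ≤ A := by
    rw [hA, hA']
    gcongr with i
    exact hqx i
  have hAA' : A ≤ A' + e' := by
    rw [hA, hA', div_add' _ _ _ hs'.ne']
    gcongr
    have : ∑ i, (1 - q i) ≤ ∑ i : Fin s, ((1 - x i) + e') :=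
      Finset.sum_le_sum fun i _ => by linarith [hxq i]
    rw [Finset.sum_add_distrib] at this
    simpa [mul_comm] using this
  -- Separates the change of the inner rate from the change of the outer rates.
  have heq : r / s * ∑ i, (1 - q i) - ρ / s * ∑ i, (1 - x i) = (r - ρ) * A + ρ * (A - A') := by
    rw [hA, hA']; ring
  rw [heq, abs_le]
  constructor <;> nlinarith

end QBZ

/-! ### Choice of the parameters -/

theorem mainTheorem3 (δ : ℝ) (hδ0 : 0 < δ) (hδ1 : δ < QBZ.H4inv (1 / 2))
    (ε : ℝ) (hε : 0 < ε) :
    ∃ s₀ : ℕ, ∀ s : ℕ, s₀ ≤ s →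
      ∃ m₀ : ℕ, ∀ m : ℕ, m₀ ≤ m →
        ∃ (n₂ : ℕ) (Q : QBZ.QuantumCode (Fin (2 ^ m - 1) × Fin n₂)) (k d : ℕ),
          QBZ.IsGeneralizedConcatenated s m n₂ Q ∧
          Q.Encodes k ∧ Q.HasMinDist d ∧
          δ / 2 ≤ (d : ℝ) / (((2 ^ m - 1 : ℕ) : ℝ) * (n₂ : ℝ)) ∧
          |(k : ℝ) / (((2 ^ m - 1 : ℕ) : ℝ) * (n₂ : ℝ)) - QBZ.bzRate δ| < ε := by
  obtain ⟨hδ, hH0, hH1⟩ := QBZ.H4_lt_half hδ0 hδ1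
  set ρ := 1 - 2 * QBZ.H4 δ with hρ
  have hρ0 : 0 < ρ := by linarith
  have hρ1 : ρ < 1 := by linarith
  -- Error budget: at most ε/4 each for the gap η below ρ, for the Riemann sum (1/s) and for
  -- rounding (3/m). The bound ρ/2 keeps ρ - η positive.
  set η := min (ε / 4) (ρ / 2) with hη
  have hη0 : 0 < η := by positivity
  have hηε : η ≤ ε / 4 := min_le_left _ _
  have hηρ : η ≤ ρ / 2 := min_le_right _ _
  have hlog : 0 < Real.log 2 := Real.log_pos (by norm_num)
  refine ⟨max 2 ⌈4 / ε⌉₊, fun s hs => ?_⟩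
  have hs2 : 2 ≤ s := (le_max_left _ _).trans hs
  have hs' : (0 : ℝ) < s := Nat.cast_pos.2 (by omega)
  have hsε : 1 / (s : ℝ) ≤ ε / 4 := by
    have : 4 / ε ≤ s := (Nat.le_ceil _).trans (Nat.cast_le.2 ((le_max_right _ _).trans hs))
    rw [div_le_iff₀ hε] at this
    rw [div_le_iff₀ hs']
    linarith
  -- The four bounds serve, in order: positive truncated exponents, the rounding error, k_j ≥ 1, and
  -- the slack in the Gilbert–Varshamov count.
  refine ⟨max (max 2 ⌈12 / ε⌉₊) (max ⌈2 / δ⌉₊ ⌈4 * (s : ℝ) ^ 2 / (η * Real.log 2)⌉₊),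
    fun m hm => ?_⟩
  have hm2 : 2 ≤ m := ((le_max_left _ _).trans (le_max_left _ _)).trans hm
  have hm' : (0 : ℝ) < m := Nat.cast_pos.2 (by omega)
  have hmε : 3 / (m : ℝ) ≤ ε / 4 := by
    have : 12 / ε ≤ m := (Nat.le_ceil _).trans
      (Nat.cast_le.2 (((le_max_right _ _).trans (le_max_left _ _)).trans hm))
    rw [div_le_iff₀ hε] at this
    rw [div_le_iff₀ hm']
    linarith
  have hmδ : 2 ≤ δ * m := by
    have : 2 / δ ≤ m := (Nat.le_ceil _).trans
      (Nat.cast_le.2 (((le_max_left _ _).trans (le_max_right _ _)).trans hm))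
    rw [div_le_iff₀ hδ0] at this
    linarith
  have hms : 4 * (s : ℝ) ^ 2 ≤ η * Real.log 2 * m := by
    have : 4 * (s : ℝ) ^ 2 / (η * Real.log 2) ≤ m := (Nat.le_ceil _).trans
      (Nat.cast_le.2 (((le_max_right _ _).trans (le_max_right _ _)).trans hm))
    rw [div_le_iff₀ (by positivity)] at this
    linarith
  have hρη : 0 < ρ - η := by linarith
  -- The least inner length for which sm/n ≤ ρ - η.
  set n := ⌈(s : ℝ) * m / (ρ - η)⌉₊ with hn
  set n₁ := 2 ^ m - 1 with hn₁
  have hn₁m : m ≤ n₁ := by have := Nat.lt_two_pow_self (n := m); omega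
  have hn₁m' : (m : ℝ) ≤ n₁ := Nat.cast_le.2 hn₁m
  have hn₁0 : (0 : ℝ) < n₁ := hm'.trans_le hn₁m'
  have hsmn : (s : ℝ) * m ≤ (ρ - η) * n := by
    have := Nat.le_ceil ((s : ℝ) * m / (ρ - η))
    rw [div_le_iff₀ hρη] at this
    linarith
  have hnsm : (ρ - η) * n ≤ s * m + 1 := by
    have := (Nat.ceil_lt_add_one (show 0 ≤ (s : ℝ) * m / (ρ - η) by positivity)).le
    rw [← hn, ← sub_le_iff_le_add, le_div_iff₀ hρη] at this
    linarith
  have hsm_le : s * m ≤ n := by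
    have : (s : ℝ) * m ≤ n :=
      hsmn.trans (mul_le_of_le_one_left (Nat.cast_nonneg _) (by linarith))
    exact_mod_cast this
  have hmn : m ≤ n := (Nat.le_mul_of_pos_left m (by omega)).trans hsm_le
  have hmn' : (m : ℝ) ≤ n := Nat.cast_le.2 hmn
  have hn0 : (0 : ℝ) < n := hm'.trans_le hmn'
  set τ : Fin s → ℝ := fun j => QBZ.gvDist (((j : ℕ) + 1) * ρ / s) with hτ
  have hδτ (j) : δ ≤ τ j := QBZ.le_gvDist hδ hH0 (QBZ.node_mem hρ0 j)
  have hτ0 (j) : 0 < τ j := hδ0.trans_le (hδτ j)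
  have hτ1 (j) : τ j ≤ 1 :=
    (QBZ.H4inv_mem (QBZ.gvDist_arg_mem hH0 (QBZ.node_mem hρ0 j))).2.trans (by norm_num)
  set k : Fin s → ℕ := fun j => ⌊δ / τ j * n₁ / 2⌋₊ with hk
  have hx1 (j) : δ / τ j ≤ 1 := (div_le_one (hτ0 j)).2 (hδτ j)
  have hkle (j) : (k j : ℝ) ≤ δ / τ j * n₁ / 2 :=
    Nat.floor_le (by have := hτ0 j; positivity)
  have hklt (j) : δ / τ j * n₁ / 2 < k j + 1 := Nat.lt_floor_add_one _
  have hk2 (j) : 2 * k j ≤ n₁ := by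
    have : 2 * (k j : ℝ) ≤ n₁ := by
      have := mul_le_of_le_one_left hn₁0.le (hx1 j)
      linarith [hkle j]
    exact_mod_cast this
  have hkb (j) : 1 ≤ k j ∧ k j ≤ 2 ^ (m - 1) - 1 := by
    constructor
    · refine Nat.le_floor ?_
      have h1 : δ ≤ δ / τ j := le_div_self hδ0.le (hτ0 j) (hτ1 j)
      have h2 := mul_le_mul h1 hn₁m' hm'.le (hδ0.le.trans h1)
      push_cast
      linarith
    -- 2 k_j ≤ 2^m - 1, where the right side is odd.
    · have h1 := hk2 j
      have h2 : 2 ^ m = 2 * 2 ^ (m - 1) := by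
        rw [← pow_succ', Nat.sub_add_cancel (by omega)]
      omega
  obtain ⟨Q, d, hgc, henc, hd, i, hi⟩ := QBZ.exists_generalizedConcatenated hs2 hsm_le
    (fun j => ⌊τ j * n⌋₊ + 1) k hkb (QBZ.sum_ballCard_lt hδ0 hδ hH0 hH1 hη0 (by omega) hsmn
      (hms.trans (mul_le_mul_of_nonneg_left hmn' (by positivity))))
  refine ⟨n, Q, _, d, hgc, henc, hd, ?_, ?_⟩
  · rw [le_div_iff₀ (by positivity)]
    have h1 : ((k i : ℝ) + 1) * (⌊τ i * n⌋₊ + 1) ≤ d := by exact_mod_cast hi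
    refine le_trans ?_ h1
    -- Both roundings down are absorbed by the +1 in each factor, so the distance bound loses
    -- nothing.
    calc δ / 2 * (n₁ * n) = (δ / τ i * n₁ / 2) * (τ i * n) := by
          have := (hτ0 i).ne'
          field_simp
      _ ≤ _ := mul_le_mul (hklt i).le (Nat.lt_floor_add_one _).le
          (by have := hτ0 i; positivity) (by positivity)
  · have hrate : ((∑ j, m * (n₁ - 2 * k j) : ℕ) : ℝ) / (n₁ * n)
        = (s * m / n) / s * ∑ j, (1 - 2 * (k j : ℝ) / n₁) := by
      rw [Nat.cast_sum, Finset.sum_div, Finset.mul_sum]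
      refine Finset.sum_congr rfl fun j _ => ?_
      rw [Nat.cast_mul, Nat.cast_sub (hk2 j)]
      push_cast
      field_simp
    rw [hrate]
    -- Rounding n up costs 1/n ≤ 1/m in the inner rate; rounding k_j down costs 2/n₁ ≤ 2/m in the
    -- outer rates.
    have h1 := QBZ.abs_rate_sub_le (s := s) (by omega) (r := s * m / n) (ρ := ρ)
      (e := η + 1 / m) (e' := 2 / m) (x := fun j => δ / τ j) (q := fun j => 2 * (k j : ℝ) / n₁)
      (by rw [div_le_iff₀ hn0]; nlinarith)
      (by
        have h3 : 1 / (n : ℝ) ≤ 1 / m := one_div_le_one_div_of_le hm' hmn'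
        have h4 : ρ - η ≤ (s * m + 1) / n := by rwa [le_div_iff₀ hn0]
        rw [add_div] at h4
        linarith)
      hρ0.le hρ1.le (fun j => by positivity)
      (fun j => by rw [div_le_one hn₁0]; exact_mod_cast hk2 j)
      (fun j => by rw [div_le_iff₀ hn₁0]; linarith [hkle j])
      (fun j => by
        have h3 : 2 / (n₁ : ℝ) ≤ 2 / m := div_le_div_of_nonneg_left (by norm_num) hm' hn₁m'
        refine le_trans ?_ (add_le_add_right h3 _)
        rw [← add_div, le_div_iff₀ hn₁0]
        linarith [hklt j])
    have h2 := QBZ.abs_riemann_sub_bzRate_le hδ0 hδ hH0 hH1 (s := s) (by omega)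
    have h3 := abs_sub_le ((s * m / n : ℝ) / s * ∑ j, (1 - 2 * (k j : ℝ) / n₁))
      (ρ / s * ∑ j, (1 - δ / τ j)) (QBZ.bzRate δ)
    have h4 : 3 / (m : ℝ) = 1 / m + 2 / m := by rw [← add_div]; norm_num
    linarith
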